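/- **Corollary (Max2SAT lower bound).** A weighted CNF $\varphi$ is a finite set of clauses (finite sets of literals) with weights $w(c)\in\mathbb{N}\cup\{\infty\}$ (written in binary); its cost $\mathrm{cost}(\varphi)$ is the minimum, over all assignments, of the total weight of the falsified clauses. Max2SAT is the problem of computing $\mathrm{cost}(\varphi)$ for a given weighted CNF $\varphi$ in which every clause has at most two literals (decision version: given also $t\in\mathbb{N}$, is $\mathrm{cost}(\varphi)\le t$?). Let $\mathrm{tw}(\varphi)$ be the treewidth of the primal graph of $\varphi$ (its vertices are the variables, two of them being adjacent if they occur together in a clause), and let $\mathrm{itw}(\varphi)$ be the treewidth of the incidence graph of $\varphi$ (its vertices are the variables and the clauses, a variable being adjacent to the clauses that contain it). Let $|\varphi|$ be the length of the input (in the decision version it includes $t$). Algorithms are deterministic multitape Turing machines; $n$ denotes the number of variables of a formula. ETH: there is $\delta>0$ such that 3-SAT cannot be solved in time $2^{\delta n}\cdot\mathrm{poly}(|\varphi|)$. SETH: for every $\delta<1$ there is $k$ such that $k$-SAT cannot be solved in time $2^{\delta n}\cdot\mathrm{poly}(|\varphi|)$. 1. If SETH holds, then for every $\varepsilon>0$,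 Max2SAT (even its decision version) can be solved neither in time $2^{(1-\varepsilon)\,\mathrm{tw}(\varphi)}\cdot\mathrm{poly}(|\varphi|)$ nor in time $2^{(1-\varepsilon)\,\mathrm{itw}(\varphi)/3}\cdot\mathrm{poly}(|\varphi|)$. 2. If ETH holds, then for every $f\colon\mathbb{N}\to\mathbb{R}$ with $f(k)=o(k)$, Max2SAT (even its decision version) can be solved neither in time $2^{f(\mathrm{tw}(\varphi))}\cdot\mathrm{poly}(|\varphi|)$ nor in time $2^{f(\mathrm{itw}(\varphi))}\cdot\mathrm{poly}(|\varphi|)$. -/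

import Mathlib

open Turing

noncomputable section

namespace MaxTwoSat

/-! ## Propositional formulas -/

/-- A literal: the variable `var`, or its negation if `pos = false`. -/
structure Literal where
  var : ℕ
  pos : Bool
deriving DecidableEq

/-- A clause is a finite set of literals. -/
abbrev Clause := Finset Literal

/-- The variables of a clause. -/
def clauseVars (c : Clause) : Finset ℕ := c.image Literal.var

/-- A formula in conjunctive normal form is a finite set of clauses. -/
abbrev CNF := Finset Clause

/-- The variables that occur in a formula. -/
def CNF.vars (φ : CNF) : Finset ℕ := φ.biUnion clauseVars

/-- `β` makes at least one literal of `c` true. -/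
def Satisfies (β : ℕ → Bool) (c : Clause) : Prop := ∃ l ∈ c, β l.var = l.pos

/-- Some assignment satisfies all clauses. -/
def CNF.Satisfiable (φ : CNF) : Prop := ∃ β : ℕ → Bool, ∀ c ∈ φ, Satisfies β c

/-- Every clause contains at most `k` literals. -/
def CNF.IsWidth (k : ℕ) (φ : CNF) : Prop := ∀ c ∈ φ, c.card ≤ k

/-- A weighted CNF: a formula with weights in `ℕ ∪ {∞}` on its clauses (clauses of weight `⊤` are
hard, the others soft). The values of `weight` outside of `clauses` are never used. -/
structure WCNF where
  clauses : CNF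
  weight : Clause → ℕ∞

open Classical in
/-- The cost of an assignment: the sum of the weights of the falsified clauses. -/
def WCNF.costOf (φ : WCNF) (β : ℕ → Bool) : ℕ∞ :=
  ∑ c ∈ φ.clauses.filter (fun c => ¬ Satisfies β c), φ.weight c

/-- The cost of a formula: the minimum cost of an assignment. (`β` may assign variables that do not
occur, which has no influence on its cost.) -/
def WCNF.cost (φ : WCNF) : ℕ∞ := ⨅ β : ℕ → Bool, φ.costOf β

/-! ## Treewidth -/

/-- A tree decomposition of a graph `G`: a finite tree `T` (which may be rooted at any node) with
bags such that the nodes whose bags contain a given vertex induce a nonempty subtree, and every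
edge is contained in a bag. -/
structure TreeDecomposition {V : Type} (G : SimpleGraph V) where
  size : ℕ
  tree : SimpleGraph (Fin size)
  isTree : tree.IsTree
  bag : Fin size → Finset V
  connected : ∀ v : V, (tree.induce {t | v ∈ bag t}).Connected
  covering : ∀ u v : V, G.Adj u v → ∃ t, u ∈ bag t ∧ v ∈ bag t

/-- The width: the maximum size of a bag, minus one. -/
def TreeDecomposition.width {V : Type} {G : SimpleGraph V} (D : TreeDecomposition G) : ℕ :=
  (Finset.univ.sup fun t => (D.bag t).card) - 1

/-- The treewidth: the minimum width of a tree decomposition. -/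
def treewidth {V : Type} (G : SimpleGraph V) : ℕ :=
  sInf (Set.range (TreeDecomposition.width (G := G)))

/-- The primal graph: the variables of `φ`, two of them being adjacent if they appear together in a
clause. -/
def primalGraph (φ : CNF) : SimpleGraph {x // x ∈ φ.vars} :=
  SimpleGraph.fromRel fun x y => ∃ c ∈ φ, x.1 ∈ clauseVars c ∧ y.1 ∈ clauseVars c

/-- The incidence graph: the clauses and the variables of `φ`, a variable being adjacent to the
clauses that contain it. -/
def incidenceGraph (φ : CNF) : SimpleGraph ({c // c ∈ φ} ⊕ {x // x ∈ φ.vars}) :=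
  SimpleGraph.fromRel fun u v => match u, v with
    | Sum.inl c, Sum.inr x => x.1 ∈ clauseVars c.1
    | _, _ => False

/-- The primal treewidth of a weighted formula. -/
def WCNF.tw (φ : WCNF) : ℕ := treewidth (primalGraph φ.clauses)

/-- The incidence treewidth of a weighted formula. -/
def WCNF.itw (φ : WCNF) : ℕ := treewidth (incidenceGraph φ.clauses)

/-! ## Encoding of formulas as strings -/

/-- The alphabet. -/
inductive Sym
  | bit (b : Bool)
  | lit (pos : Bool)
  | clause
  | weight
  | infty
  | bound
deriving DecidableEq, Fintype

/-- A natural number in binary, least significant bit first. -/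
def encodeNat (n : ℕ) : List Sym := n.bits.map Sym.bit

/-- A weight: a number in binary, or the symbol for `∞`. -/
def encodeWeight (w : ℕ∞) : List Sym := if w = ⊤ then [Sym.infty] else encodeNat w.toNat

/-- A literal: its sign followed by its variable in binary. -/
def encodeLiteral (l : Literal) : List Sym := Sym.lit l.pos :: encodeNat l.var

/-- A clause, given as a list of literals. -/
def encodeClause (c : List Literal) : List Sym := Sym.clause :: c.flatMap encodeLiteral

/-- The list `L` of lists of literals lists every clause of `φ` exactly once, and every literal of
each clause exactly once. -/
structure IsListing (L : List (List Literal)) (φ : CNF) : Prop where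
  literals_nodup : ∀ c ∈ L, c.Nodup
  clauses_nodup : (L.map List.toFinset).Nodup
  clauses_eq : (L.map List.toFinset).toFinset = φ

/-- A CNF together with an order in which it is written down. -/
structure CNFInput where
  formula : CNF
  list : List (List Literal)
  isListing : IsListing list formula

/-- The string that represents a CNF. -/
def CNFInput.encode (I : CNFInput) : List Sym := I.list.flatMap encodeClause

/-- A weighted CNF together with an order in which it is written down. -/
structure WCNFInput where
  formula : WCNF
  list : List (List Literal)
  isListing : IsListing list formula.clauses

/-- The string that represents a weighted CNF: each clause is followed by its weight. -/
def WCNFInput.encode (I : WCNFInput) : List Sym :=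
  I.list.flatMap fun c =>
    encodeClause c ++ Sym.weight :: encodeWeight (I.formula.weight c.toFinset)

/-! ## Running times -/

/-- Some deterministic multi-stack Turing machine maps, for every instance `i`, the string `enc i`
to the string `ans i` in at most `T i` steps. -/
def SolvableInTime {ι Γ₀ Γ₁ : Type} (enc : ι → List Γ₀) (ans : ι → List Γ₁) (T : ι → ℝ) : Prop :=
  ∃ M : TM2ComputableAux Γ₀ Γ₁, ∀ i : ι, ∃ m : ℕ, (m : ℝ) ≤ T i ∧
    Nonempty (TM2OutputsInTime M.tm ((enc i).map M.inputAlphabet.invFun)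
      (some ((ans i).map M.outputAlphabet.invFun)) m)

/-- Solvable in time `g (κ i) * poly (|enc i|)`, where `κ` is a parameter of the instance. -/
def SolvableInParamTime {ι Γ₀ Γ₁ : Type} (enc : ι → List Γ₀) (ans : ι → List Γ₁)
    (κ : ι → ℕ) (g : ℕ → ℝ) : Prop :=
  ∃ p : Polynomial ℕ,
    SolvableInTime enc ans fun i => g (κ i) * ((p.eval (enc i).length : ℕ) : ℝ)

open Classical in
/-- `k`-SAT can be decided in time `g n * poly (|φ|)`, where `n` is the number of variables of the
input `φ`. -/
def KSATSolvable (k : ℕ) (g : ℕ → ℝ) : Prop :=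
  SolvableInParamTime (ι := {I : CNFInput // I.formula.IsWidth k})
    (fun I => I.1.encode) (fun I => [decide I.1.formula.Satisfiable])
    (fun I => I.1.formula.vars.card) g

/-- The exponential time hypothesis: for some `δ > 0`, 3-SAT cannot be solved in time
`2 ^ (δ n) * poly (|φ|)`. -/
def ETH : Prop := ∃ δ : ℝ, 0 < δ ∧ ¬ KSATSolvable 3 fun n => (2 : ℝ) ^ (δ * (n : ℝ))

/-- The strong exponential time hypothesis: for every `δ < 1` there is a `k` such that `k`-SAT
cannot be solved in time `2 ^ (δ n) * poly (|φ|)`. -/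
def SETH : Prop := ∀ δ : ℝ, δ < 1 → ∃ k : ℕ, ¬ KSATSolvable k fun n => (2 : ℝ) ^ (δ * (n : ℝ))

/-- Weighted CNFs whose clauses contain at most two literals. -/
abbrev W2CNFInput := {I : WCNFInput // I.formula.clauses.IsWidth 2}

/-- The cost of a given weighted 2-CNF `φ` can be computed in time `g (κ φ) * poly (|φ|)`. -/
def Max2SATComputable (κ : WCNF → ℕ) (g : ℕ → ℝ) : Prop :=
  SolvableInParamTime (ι := W2CNFInput)
    (fun I => I.1.encode) (fun I => encodeWeight I.1.formula.cost) (fun I => κ I.1.formula) g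

open Classical in
/-- Given a weighted 2-CNF `φ` and a number `t` in binary, `cost φ ≤ t` can be decided in time
`g (κ φ) * poly (|φ| + |t|)`. -/
def Max2SATDecidable (κ : WCNF → ℕ) (g : ℕ → ℝ) : Prop :=
  SolvableInParamTime (ι := W2CNFInput × ℕ)
    (fun I => I.1.1.encode ++ Sym.bound :: encodeNat I.2)
    (fun I => [decide (I.1.1.formula.cost ≤ (I.2 : ℕ∞))]) (fun I => κ I.1.1.formula) g

/-- Max2SAT can be solved in time `g (κ φ) * poly (|φ|)`, as the problem of computing the optimum or
(at least) as a decision problem; the negation of this excludes both. -/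
def Max2SATSolvable (κ : WCNF → ℕ) (g : ℕ → ℝ) : Prop :=
  Max2SATComputable κ g ∨ Max2SATDecidable κ g

end MaxTwoSat

end

noncomputable section

namespace MaxTwoSat

/-! ## Bounded runs -/

/-! A CNF with `n` variables, of any clause width, is turned in polynomial time into a weighted
2-CNF whose primal and incidence treewidth are at most `n + O(1)`, and whose cost reveals
satisfiability. A fast Max2SAT algorithm would therefore give an equally fast `k`-SAT algorithm for
every `k`, against SETH or ETH.

Read the CNF as a sequence of `Q` tokens: the beginnings of clauses and the occurrences of literals.
The chain variable `z c` means that at position `c` no literal of the current clause has been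
selected yet. At a literal, the chain may stay as it is, or fall from true to false, and the
selecting variable may be true only at a fall and only if the literal is true. The weights at
position `c` are `2 ^ c` or `3 * 2 ^ c`. Compare the cost paid so far, plus 1, with the potential `2
^ c` if `z c` is false and `2 * 2 ^ c` if it is true. A false chain pays `2 ^ c` and a chain that
stays true pays `2 * 2 ^ c`, which both double the potential; a fall with selection pays nothing and
keeps it at `2 ^ (c + 1)`; a fall without selection overpays by `2 ^ c`. A clause beginning always
pays `3 * 2 ^ c`, which is exact only if the preceding chain has fallen. Hence the cost is at least
`2 ^ (Q + 1) - 1`, with equality iff every clause has a selected true literal (`cost_reduct`).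

The original variables are put into all bags. What remains is a path-like structure in which each
position contributes boundedly many vertices and only neighbouring positions interact
(`tw_reduct_le`, `itw_reduct_le`).

The reduction has to run on a Turing machine. Weights and variables are powers of two up to constant
prefixes and suffixes of the binary representation, so a finite transducer with one counter writes
them (`output_tokens`). The optimum is `2 ^ (Q + 1) - 1` iff all its bits are 1, which a finite test
on the answer recognises; for the decision version the transducer also writes this bound.
`composed_outputs` joins transducer, Max2SAT machine and test with polynomial overhead. -/

/-- `f` leads from `a` to `b` in at most `n` steps. -/
def Within {α : Type} (f : α → Option α) (n : ℕ) (a b : α) : Prop :=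
  ∃ k ≤ n, (flip bind f)^[k] (some a) = some b

namespace Within

variable {α : Type} {f : α → Option α} {a b c : α} {m n : ℕ}

lemma refl (a : α) : Within f 0 a a := ⟨0, le_rfl, rfl⟩

lemma mono (h : Within f m a b) (hmn : m ≤ n) : Within f n a b :=
  let ⟨k, hk, e⟩ := h; ⟨k, hk.trans hmn, e⟩

lemma trans (h₁ : Within f m a b) (h₂ : Within f n b c) : Within f (m + n) a c := by
  obtain ⟨k, hk, e⟩ := h₁
  obtain ⟨l, hl, e'⟩ := h₂
  refine ⟨l + k, by omega, ?_⟩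
  rw [Function.iterate_add_apply, e, e']

lemma single (h : f a = some b) : Within f 1 a b := ⟨1, le_rfl, h⟩

lemma head (h : f a = some b) (h' : Within f n b c) : Within f (n + 1) a c :=
  ((single h).trans h').mono (by omega)

end Within

/-! ## A transducer with a counter, followed by a given machine -/

/-- What the transducer can do: write a symbol, write as many copies of a bit as the counter says,
increment the counter, or finish. -/
inductive Item
  | sym (s : Sym)
  | rep (b : Bool)
  | inc
  | done
deriving DecidableEq, Fintype

/-- The string written by a list of items, if the counter is `c` at the beginning. -/
def emit : ℕ → List Item → List Sym
  | _, [] => []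
  | c, .sym s :: l => s :: emit c l
  | c, .rep b :: l => List.replicate c (.bit b) ++ emit c l
  | c, .inc :: l => emit (c + 1) l
  | c, .done :: l => emit c l

/-- The number of increments in a list of items. -/
def incs (l : List Item) : ℕ := l.count .inc

/-- A transducer: the items to execute when a symbol, or the end of the string, is read in one of
two states, and the state afterwards. -/
structure Transducer where
  items : Option Sym → Bool → List Item
  next : Sym → Bool → Bool

/-- The output of a transducer. -/
def Transducer.output (P : Transducer) : List Sym → ℕ → Bool → List Sym
  | [], c, p => emit c (P.items none p)
  | s :: x, c, p => emit c (P.items (some s) p) ++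
      P.output x (c + incs (P.items (some s) p)) (P.next s p)

/-- The stacks of the transducer. -/
inductive Stk
  | inp | todo | cnt | tmp | out | res
deriving DecidableEq

instance : Fintype Stk where
  elems := {.inp, .todo, .cnt, .tmp, .out, .res}
  complete s := by cases s <;> decide

/-- The registers of the transducer. -/
structure Reg where
  s : Option Sym
  t : Option Item
  u : Bool
  pend : Bool
  acc : Bool
deriving DecidableEq, Fintype

/-- The initial values of the registers. -/
def Reg.init : Reg := ⟨none, none, false, false, true⟩

/-- The labels of the transducer. -/
inductive Lbl
  | main
  | disp (s : Option Sym) (p : Bool)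
  | exec
  | item (t : Option Item)
  | up (b : Bool)
  | down
  | clear
  | move
  | post
deriving DecidableEq, Fintype

section Machine

variable {Γ₁ : Type} (P : Transducer) (M : TM2ComputableAux Sym Γ₁) (test : Γ₁ → Bool)

/-- The alphabets of the composed machine. -/
abbrev alph : M.tm.K ⊕ Stk → Type
  | .inl k => M.tm.Γ k
  | .inr .inp => Sym
  | .inr .todo => Item
  | .inr .cnt => Unit
  | .inr .tmp => Unit
  | .inr .out => Sym
  | .inr .res => Bool

/-- The statements of the composed machine. -/
abbrev CStmt := TM2.Stmt (alph M) (M.tm.Λ ⊕ Lbl) (M.tm.σ × Reg)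

/-- The configurations of the composed machine. -/
abbrev CCfg := TM2.Cfg (alph M) (M.tm.Λ ⊕ Lbl) (M.tm.σ × Reg)

/-- The statements of the given machine as statements of the composed machine. -/
def embStmt : TM2.Stmt M.tm.Γ M.tm.Λ M.tm.σ → CStmt M
  | .push k f q => .push (.inl k) (fun v => f v.1) (embStmt q)
  | .peek k f q => .peek (.inl k) (fun v x => (f v.1 x, v.2)) (embStmt q)
  | .pop k f q => .pop (.inl k) (fun v x => (f v.1 x, v.2)) (embStmt q)
  | .load a q => .load (fun v => (a v.1, v.2)) (embStmt q)
  | .branch p q₁ q₂ => .branch (fun v => p v.1) (embStmt q₁) (embStmt q₂)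
  | .goto l => .goto fun v => .inl (l v.1)
  -- Halting becomes a jump within the same statement, so simulated runs keep their exact length.
  | .halt => .goto fun _ => .inr .post

/-- Jump to a label of the transducer. -/
abbrev jump (l : Lbl) : CStmt M := .goto fun _ => .inr l

/-- Push a list of items, the first one to the top. -/
def pushItems (q : CStmt M) : List Item → CStmt M
  | [] => q
  | t :: l => pushItems (.push (.inr .todo) (fun _ => t) q) l

/-- The execution of an item. -/
def itemStmt : Option Item → CStmt M
  | none => jump M .main
  | some (.sym s) => .push (.inr .out) (fun _ => s) (jump M .exec)
  | some (.rep b) => jump M (.up b)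
  | some .inc => .push (.inr .cnt) (fun _ => ()) (jump M .exec)
  | some .done => jump M .clear

/-- The program of the transducer and of the final test. -/
def prog : Lbl → CStmt M
  | .main => .pop (.inr .inp) (fun v x => (v.1, { v.2 with s := x }))
      -- What is pushed next is a fixed statement for each symbol and flag, so both are passed on in
      -- the label.
      (.goto fun v => .inr (.disp v.2.s v.2.pend))
  | .disp none p => pushItems M (jump M .exec) (P.items none p ++ [Item.done])
  | .disp (some s) p => .load (fun v => (v.1, { v.2 with pend := P.next s p }))
      (pushItems M (jump M .exec) (P.items (some s) p))
  | .exec => .pop (.inr .todo) (fun v x => (v.1, { v.2 with t := x }))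
      (.goto fun v => .inr (.item v.2.t))
  | .item t => itemStmt M t
  | .up b => .pop (.inr .cnt) (fun v x => (v.1, { v.2 with u := x.isSome }))
      (.branch (fun v => v.2.u)
        (.push (.inr .tmp) (fun _ => ()) (.push (.inr .out) (fun _ => Sym.bit b) (jump M (.up b))))
        (jump M .down))
  | .down => .pop (.inr .tmp) (fun v x => (v.1, { v.2 with u := x.isSome }))
      (.branch (fun v => v.2.u) (.push (.inr .cnt) (fun _ => ()) (jump M .down)) (jump M .exec))
  | .clear => .pop (.inr .cnt) (fun v x => (v.1, { v.2 with u := x.isSome }))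
      (.branch (fun v => v.2.u) (jump M .clear) (jump M .move))
  -- The last symbol written lies on top of the output stack; moving the symbols one by one restores
  -- their order.
  | .move => .pop (.inr .out) (fun v x => (v.1, { v.2 with s := x }))
      (.branch (fun v => v.2.s.isSome)
        (.push (.inl M.tm.k₀) (fun v => M.inputAlphabet.symm (v.2.s.getD .clause)) (jump M .move))
        (.load (fun v => (v.1, Reg.init)) (.goto fun _ => .inl M.tm.main)))
  | .post => .pop (.inl M.tm.k₁)
      (fun v x => (v.1, { v.2 with
        u := x.isSome
        acc := v.2.acc && (x.map fun y => test (M.outputAlphabet y)).getD true }))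
      (.branch (fun v => v.2.u) (jump M .post)
        -- The final configuration has to be exactly `haltList`: initial registers, and no stack but
        -- the result nonempty. This is also why the counter was cleared.
        (.push (.inr .res) (fun v => v.2.acc) (.load (fun v => (v.1, Reg.init)) .halt)))

/-- The transducer, followed by the given machine, followed by the test whether all symbols of the
result satisfy `test`. -/
def composed : TM2ComputableAux Sym Bool where
  tm :=
    { K := M.tm.K ⊕ Stk
      kDecidableEq := inferInstance
      kFin := letI := M.tm.kFin; inferInstance
      k₀ := .inr .inp
      k₁ := .inr .res
      Γ := alph M
      Λ := M.tm.Λ ⊕ Lbl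
      main := .inr .main
      ΛFin := letI := M.tm.ΛFin; inferInstance
      σ := M.tm.σ × Reg
      initialState := (M.tm.initialState, Reg.init)
      σFin := letI := M.tm.σFin; inferInstance
      Γk₀Fin := inferInstanceAs (Fintype Sym)
      m := Sum.elim (fun l => embStmt M (M.tm.m l)) (prog P M test) }
  inputAlphabet := Equiv.refl Sym
  outputAlphabet := Equiv.refl Bool

/-- The stacks of the composed machine. -/
def stks (S : ∀ k, List (M.tm.Γ k)) (i : List Sym) (t : List Item) (c d : ℕ) (o : List Sym)
    (r : List Bool) : ∀ k, List (alph M k)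
  | .inl k => S k
  | .inr .inp => i
  | .inr .todo => t
  | .inr .cnt => List.replicate c ()
  | .inr .tmp => List.replicate d ()
  | .inr .out => o
  | .inr .res => r

variable {M}
variable (S : ∀ k, List (M.tm.Γ k)) (i : List Sym) (t : List Item) (c d : ℕ) (o : List Sym)
    (r : List Bool)

lemma update_inl (k : M.tm.K) (x : List (M.tm.Γ k)) :
    Function.update (stks M S i t c d o r) (.inl k) x =
      stks M (Function.update S k x) i t c d o r := by
  funext j
  rcases j with j | j
  · by_cases h : j = k
    · subst h; simp [stks]
    · rw [Function.update_of_ne (by simpa using h)]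
      simp [stks, h]
  · rw [Function.update_of_ne (by simp)]
    cases j <;> rfl

lemma update_inp (x : List Sym) :
    Function.update (stks M S i t c d o r) (.inr .inp) x = stks M S x t c d o r := by
  funext j
  rcases j with j | j | j | j | j | j | j <;> rfl

lemma update_todo (x : List Item) :
    Function.update (stks M S i t c d o r) (.inr .todo) x = stks M S i x c d o r := by
  funext j
  rcases j with j | j | j | j | j | j | j <;> rfl

lemma pop_cnt : Function.update (stks M S i t c d o r) (.inr .cnt)
    (stks M S i t c d o r (.inr .cnt)).tail = stks M S i t (c - 1) d o r := by
  funext j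
  rcases j with j | j | j | j | j | j | j <;> first | rfl | exact List.tail_replicate ..

lemma push_cnt : Function.update (stks M S i t c d o r) (.inr .cnt)
    (() :: stks M S i t c d o r (.inr .cnt)) = stks M S i t (c + 1) d o r := by
  funext j
  rcases j with j | j | j | j | j | j | j <;> rfl

lemma pop_tmp : Function.update (stks M S i t c d o r) (.inr .tmp)
    (stks M S i t c d o r (.inr .tmp)).tail = stks M S i t c (d - 1) o r := by
  funext j
  rcases j with j | j | j | j | j | j | j <;> first | rfl | exact List.tail_replicate ..

lemma push_tmp : Function.update (stks M S i t c d o r) (.inr .tmp)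
    (() :: stks M S i t c d o r (.inr .tmp)) = stks M S i t c (d + 1) o r := by
  funext j
  rcases j with j | j | j | j | j | j | j <;> rfl

lemma update_out (x : List Sym) :
    Function.update (stks M S i t c d o r) (.inr .out) x = stks M S i t c d x r := by
  funext j
  rcases j with j | j | j | j | j | j | j <;> rfl

lemma update_res (x : List Bool) :
    Function.update (stks M S i t c d o r) (.inr .res) x = stks M S i t c d o x := by
  funext j
  rcases j with j | j | j | j | j | j | j <;> rfl

variable (M) in
/-- A configuration at a label of the transducer. -/
def cfg (l : Lbl) (v : M.tm.σ × Reg) (S : ∀ k, List (M.tm.Γ k)) (i : List Sym) (t : List Item)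
    (c d : ℕ) (o : List Sym) (r : List Bool) : CCfg M :=
  ⟨some (.inr l), v, stks M S i t c d o r⟩

variable (M) in
/-- The step function of the composed machine. -/
abbrev cstep : CCfg M → Option (CCfg M) := (composed P M test).tm.step

variable (v : M.tm.σ × Reg)

lemma cstep_cfg (l : Lbl) : cstep P M test (cfg M l v S i t c d o r) =
    some (TM2.stepAux (prog P M test l) v (stks M S i t c d o r)) := rfl

/-! ### The given machine inside of the composed machine -/

variable (M) in
/-- A configuration of the given machine as a configuration of the composed machine. -/
def embCfg (C : M.tm.Cfg) : CCfg M :=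
  ⟨some (C.l.elim (.inr .post) .inl), (C.var, Reg.init), stks M C.stk [] [] 0 0 [] []⟩

lemma stepAux_embStmt (q : TM2.Stmt M.tm.Γ M.tm.Λ M.tm.σ) (w : M.tm.σ) :
    TM2.stepAux (embStmt M q) (w, Reg.init) (stks M S [] [] 0 0 [] []) =
      embCfg M (TM2.stepAux q w S) := by
  induction q generalizing w S with
  | push k f q ih => rw [embStmt, TM2.stepAux, update_inl, ih]; rfl
  | peek k f q ih => rw [embStmt, TM2.stepAux]; exact ih _ _
  | pop k f q ih => rw [embStmt, TM2.stepAux, update_inl]; exact ih _ _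
  | load a q ih => rw [embStmt, TM2.stepAux]; exact ih _ _
  | branch p q₁ q₂ ih₁ ih₂ =>
    rw [embStmt, TM2.stepAux, TM2.stepAux]
    cases h : p w <;> simp only [cond_true, cond_false, ih₁, ih₂]
  | goto l => rfl
  | halt => rfl

lemma cstep_embCfg {C C' : M.tm.Cfg} (h : M.tm.step C = some C') :
    cstep P M test (embCfg M C) = some (embCfg M C') := by
  obtain ⟨l, w, S⟩ := C
  cases l with
  | none => simp [FinTM2.step, TM2.step] at h
  | some l =>
    have h : TM2.stepAux (M.tm.m l) w S = C' := Option.some.inj h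
    subst h
    exact congrArg some (stepAux_embStmt S _ w)

lemma within_embCfg {n : ℕ} {C C' : M.tm.Cfg} (h : Within M.tm.step n C C') :
    Within (cstep P M test) n (embCfg M C) (embCfg M C') := by
  obtain ⟨k, hk, e⟩ := h
  refine ⟨k, hk, ?_⟩
  clear hk
  induction k generalizing C with
  | zero => simp only [Function.iterate_zero, id_eq, Option.some.injEq] at e ⊢; rw [e]
  | succ k ih =>
    rw [Function.iterate_succ_apply] at e ⊢
    cases h : M.tm.step C with
    | none =>
      have : flip bind M.tm.step (some C) = none := h
      rw [this] at e
      have hn : ∀ j : ℕ, (flip bind M.tm.step)^[j] none = none := fun j => by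
        induction j with
        | zero => rfl
        | succ j ih => rw [Function.iterate_succ_apply]; exact ih
      rw [hn] at e
      cases e
    | some C₁ =>
      have h1 : flip bind M.tm.step (some C) = some C₁ := h
      have h2 : flip bind (cstep P M test) (some (embCfg M C)) = some (embCfg M C₁) :=
        cstep_embCfg P test h
      rw [h1] at e
      rw [h2]
      exact ih e

/-! ### The phases of the composed machine -/

/-- All pushes belong to one statement, so the whole list is pushed within a single step. -/
lemma stepAux_pushItems (q : CStmt M) (l : List Item) :
    TM2.stepAux (pushItems M q l) v (stks M S i t c d o r) =
      TM2.stepAux q v (stks M S i (l ++ t) c d o r) := by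
  induction l generalizing q with
  | nil => rfl
  | cons a l ih =>
    rw [pushItems, ih, TM2.stepAux, update_todo]
    rfl

end Machine

section Machine

variable {Γ₁ : Type} (P : Transducer) {M : TM2ComputableAux Sym Γ₁} (test : Γ₁ → Bool)

/-- The two register contents agree, up to the registers that hold intermediate values. -/
def Keeps (v w : M.tm.σ × Reg) : Prop :=
  w.1 = v.1 ∧ w.2.pend = v.2.pend ∧ w.2.acc = v.2.acc

lemma Keeps.rfl {v : M.tm.σ × Reg} : Keeps v v := ⟨Eq.refl _, Eq.refl _, Eq.refl _⟩

lemma Keeps.trans {u v w : M.tm.σ × Reg} (h : Keeps u v) (h' : Keeps v w) : Keeps u w :=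
  ⟨h'.1.trans h.1, h'.2.1.trans h.2.1, h'.2.2.trans h.2.2⟩

variable (S : ∀ k, List (M.tm.Γ k)) (i : List Sym) (t : List Item) (c d : ℕ) (o : List Sym)
    (r : List Bool) (v : M.tm.σ × Reg)

/-- Reading the counter destroys it: it moves to the auxiliary stack, one bit being written for each
unit, and `within_down` moves it back. -/
lemma within_up (b : Bool) : ∃ w, Keeps v w ∧ Within (cstep P M test) (c + 1)
    (cfg M (.up b) v S i t c d o r)
    (cfg M .down w S i t 0 (c + d) (List.replicate c (.bit b) ++ o) r) := by
  induction c generalizing d o v with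
  | zero =>
    refine ⟨(v.1, { v.2 with u := false }), ⟨rfl, rfl, rfl⟩, Within.single ?_⟩
    rw [cstep_cfg, prog, TM2.stepAux, pop_cnt, Nat.zero_add]
    rfl
  | succ c ih =>
    obtain ⟨w, hw, h⟩ := ih (d + 1) (Sym.bit b :: o) (v.1, { v.2 with u := true })
    refine ⟨w, Keeps.trans ⟨rfl, rfl, rfl⟩ hw, Within.head
      (b := cfg M (.up b) (v.1, { v.2 with u := true }) S i t c (d + 1) (Sym.bit b :: o) r) ?_ ?_⟩
    · rw [cstep_cfg, prog, TM2.stepAux, pop_cnt]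
      refine congrArg some ?_
      change TM2.stepAux (.push (.inr .tmp) (fun _ => ()) (.push (.inr .out) (fun _ => Sym.bit b)
        (jump M (.up b)))) (v.1, { v.2 with u := true }) _ = _
      rw [TM2.stepAux, push_tmp, TM2.stepAux, update_out]
      rfl
    · have e : c + (d + 1) = c + 1 + d := by omega
      have e' : List.replicate c (Sym.bit b) ++ Sym.bit b :: o =
          List.replicate (c + 1) (Sym.bit b) ++ o := by
        rw [List.replicate_succ', List.append_assoc]; rfl
      rw [e, e'] at h
      exact h

lemma within_down : ∃ w, Keeps v w ∧ Within (cstep P M test) (d + 1)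
    (cfg M .down v S i t c d o r) (cfg M .exec w S i t (c + d) 0 o r) := by
  induction d generalizing c v with
  | zero =>
    refine ⟨(v.1, { v.2 with u := false }), ⟨rfl, rfl, rfl⟩, Within.single ?_⟩
    rw [cstep_cfg, prog, TM2.stepAux, pop_tmp]
    rfl
  | succ d ih =>
    obtain ⟨w, hw, h⟩ := ih (c + 1) (v.1, { v.2 with u := true })
    refine ⟨w, Keeps.trans ⟨rfl, rfl, rfl⟩ hw, Within.head
      (b := cfg M .down (v.1, { v.2 with u := true }) S i t (c + 1) d o r) ?_ ?_⟩
    · rw [cstep_cfg, prog, TM2.stepAux, pop_tmp]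
      refine congrArg some ?_
      change TM2.stepAux (.push (.inr .cnt) (fun _ => ()) (jump M .down))
        (v.1, { v.2 with u := true }) _ = _
      rw [TM2.stepAux, push_cnt]
      rfl
    · have e : c + 1 + d = c + (d + 1) := by omega
      rw [e] at h
      exact h

lemma within_exec (a : Item) : Within (cstep P M test) 1 (cfg M .exec v S i (a :: t) c d o r)
    (cfg M (.item (some a)) (v.1, { v.2 with t := some a }) S i t c d o r) := by
  refine Within.single ?_
  rw [cstep_cfg, prog, TM2.stepAux, update_todo]
  rfl

/-- The bound comes from `rep`: two steps to fetch the item and jump, and `c + 1` steps each for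
emptying and restoring the counter. -/
lemma within_item (a : Item) (ha : a ≠ .done) : ∃ w, Keeps v w ∧
    Within (cstep P M test) (2 * c + 4) (cfg M .exec v S i (a :: t) c 0 o r)
      (cfg M .exec w S i t (c + incs [a]) 0 ((emit c [a]).reverse ++ o) r) := by
  have h₁ := within_exec P test S i t c 0 o r v a
  set v₁ : M.tm.σ × Reg := (v.1, { v.2 with t := some a }) with hv₁
  have k₁ : Keeps v v₁ := ⟨rfl, rfl, rfl⟩
  clear_value v₁
  cases a with
  | sym s =>
    refine ⟨v₁, k₁, (h₁.trans (Within.single ?_)).mono (by omega : 1 + 1 ≤ _)⟩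
    rw [cstep_cfg, prog, itemStmt, TM2.stepAux, update_out]
    rfl
  | rep b =>
    obtain ⟨w, hw, h₂⟩ := within_up P test S i t c 0 o r v₁ b
    obtain ⟨w', hw', h₃⟩ := within_down P test S i t 0 (c + 0) (List.replicate c (.bit b) ++ o) r w
    refine ⟨w', (k₁.trans hw).trans hw', ?_⟩
    have h₀ : Within (cstep P M test) 1 (cfg M (.item (some (.rep b))) v₁ S i t c 0 o r)
      (cfg M (.up b) v₁ S i t c 0 o r) := Within.single rfl
    have h := ((h₁.trans h₀).trans h₂).trans h₃
    have e : (emit c [.rep b]).reverse ++ o = List.replicate c (.bit b) ++ o := by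
      simp [emit]
    have e' : c + incs [.rep b] = 0 + (c + 0) := by simp [incs]
    rw [e, e']
    exact h.mono (by omega)
  | inc =>
    refine ⟨v₁, k₁, (h₁.trans (Within.single ?_)).mono (by omega : 1 + 1 ≤ _)⟩
    rw [cstep_cfg, prog, itemStmt, TM2.stepAux, push_cnt]
    rfl
  | done => exact absurd rfl ha

lemma emit_cons (a : Item) (l : List Item) :
    emit c (a :: l) = emit c [a] ++ emit (c + incs [a]) l := by
  cases a <;> simp [emit, incs]

lemma incs_cons (a : Item) (l : List Item) : incs (a :: l) = incs [a] + incs l := by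
  simp [incs, List.count_cons]
  omega

lemma within_items (l : List Item) (hl : .done ∉ l) (N : ℕ) (hN : c + incs l ≤ N) :
    ∃ w, Keeps v w ∧
    Within (cstep P M test) (l.length * (2 * N + 4)) (cfg M .exec v S i (l ++ t) c 0 o r)
      (cfg M .exec w S i t (c + incs l) 0 ((emit c l).reverse ++ o) r) := by
  induction l generalizing c o v with
  | nil => exact ⟨v, Keeps.rfl, (Within.refl _).mono (by simp)⟩
  | cons a l ih =>
    rw [List.mem_cons, not_or] at hl
    rw [incs_cons] at hN
    obtain ⟨w, hw, h⟩ := within_item P test S i (l ++ t) c o r v a (Ne.symm hl.1)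
    obtain ⟨w', hw', h'⟩ := ih (c + incs [a]) ((emit c [a]).reverse ++ o) w hl.2 (by omega)
    refine ⟨w', hw.trans hw', ?_⟩
    have e : (emit c (a :: l)).reverse ++ o =
        (emit (c + incs [a]) l).reverse ++ ((emit c [a]).reverse ++ o) := by
      rw [emit_cons]; simp
    rw [e, incs_cons, ← Nat.add_assoc]
    refine (h.trans h').mono ?_
    rw [List.length_cons, Nat.succ_mul l.length]
    omega

lemma within_exec_nil : ∃ w, Keeps v w ∧ Within (cstep P M test) 2
    (cfg M .exec v S i [] c d o r) (cfg M .main w S i [] c d o r) := by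
  refine ⟨(v.1, { v.2 with t := none }), ⟨rfl, rfl, rfl⟩,
    Within.head (b := cfg M (.item none) (v.1, { v.2 with t := none }) S i [] c d o r) ?_
      (Within.single ?_)⟩
  · rw [cstep_cfg, prog, TM2.stepAux, update_todo]
    rfl
  · rfl

lemma within_clear : ∃ w, Keeps v w ∧ Within (cstep P M test) (c + 1)
    (cfg M .clear v S i t c d o r) (cfg M .move w S i t 0 d o r) := by
  induction c generalizing v with
  | zero =>
    refine ⟨(v.1, { v.2 with u := false }), ⟨rfl, rfl, rfl⟩, Within.single ?_⟩
    rw [cstep_cfg, prog, TM2.stepAux, pop_cnt]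
    rfl
  | succ c ih =>
    obtain ⟨w, hw, h⟩ := ih (v.1, { v.2 with u := true })
    refine ⟨w, Keeps.trans ⟨rfl, rfl, rfl⟩ hw, Within.head ?_ h⟩
    rw [cstep_cfg, prog, TM2.stepAux, pop_cnt]
    rfl

/-! ### Handing the string over to the given machine -/

variable (M) in
/-- The given machine with a given string on its input stack. -/
def inputStk (x : List Sym) : ∀ k, List (M.tm.Γ k) :=
  (initList M.tm (x.map M.inputAlphabet.symm)).stk

lemma stks_initList (tm : FinTM2) (x : List (tm.Γ tm.k₀)) :
    (initList tm x).stk = Function.update (fun _ => []) tm.k₀ x := by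
  funext k
  by_cases h : k = tm.k₀
  · subst h; simp [initList]
  · simp [initList, h]

lemma stks_haltList (tm : FinTM2) (x : List (tm.Γ tm.k₁)) :
    (haltList tm x).stk = Function.update (fun _ => []) tm.k₁ x := by
  funext k
  by_cases h : k = tm.k₁
  · subst h; simp [haltList]
  · simp [haltList, h]

lemma update_inputStk (x : List Sym) (s : Sym) :
    Function.update (inputStk M x) M.tm.k₀ (M.inputAlphabet.symm s :: inputStk M x M.tm.k₀) =
      inputStk M (s :: x) := by
  simp [inputStk, stks_initList]

lemma within_move (x : List Sym) (hv : v.1 = M.tm.initialState) :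
    Within (cstep P M test) (o.length + 1) (cfg M .move v (inputStk M x) [] [] 0 0 o [])
      (embCfg M (initList M.tm ((o.reverse ++ x).map M.inputAlphabet.symm))) := by
  induction o generalizing x v with
  | nil =>
    refine Within.single ?_
    rw [cstep_cfg, prog, TM2.stepAux, update_out]
    refine congrArg some ?_
    change (⟨some (.inl M.tm.main), (v.1, Reg.init), _⟩ : CCfg M) = _
    rw [hv]
    rfl
  | cons s o ih =>
    have h := ih (v.1, { v.2 with s := some s }) (s :: x) hv
    rw [List.reverse_cons, List.append_assoc]
    refine Within.head ?_ h
    rw [cstep_cfg, prog, TM2.stepAux, update_out]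
    refine congrArg some ?_
    change TM2.stepAux (.push (.inl M.tm.k₀) (fun v => M.inputAlphabet.symm (v.2.s.getD .clause))
      (jump M .move)) (v.1, { v.2 with s := some s }) _ = _
    rw [TM2.stepAux, update_inl]
    change TM2.stepAux (jump M .move) (v.1, { v.2 with s := some s })
      (stks M (Function.update (inputStk M x) M.tm.k₀
        (M.inputAlphabet.symm s :: inputStk M x M.tm.k₀)) [] [] 0 0 o []) = _
    rw [update_inputStk]
    rfl

/-! ### Testing the answer of the given machine -/

variable (M) in
/-- The given machine with a given string on its output stack. -/
def outputStk (y : List Γ₁) : ∀ k, List (M.tm.Γ k) :=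
  (haltList M.tm (y.map M.outputAlphabet.symm)).stk

lemma outputStk_self (y : List Γ₁) :
    outputStk M y M.tm.k₁ = y.map M.outputAlphabet.symm := by
  simp [outputStk, stks_haltList]

lemma update_outputStk (y y' : List Γ₁) :
    Function.update (outputStk M y) M.tm.k₁ (y'.map M.outputAlphabet.symm) = outputStk M y' := by
  simp [outputStk, stks_haltList]

lemma outputStk_nil : outputStk M [] = fun _ => [] := by
  simp [outputStk, stks_haltList]

lemma within_post (y : List Γ₁) (hv : v.1 = M.tm.initialState) :
    Within (cstep P M test) (y.length + 1) (cfg M .post v (outputStk M y) [] [] 0 0 [] [])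
      ⟨none, (M.tm.initialState, Reg.init),
        stks M (fun _ => []) [] [] 0 0 [] [v.2.acc && y.all test]⟩ := by
  induction y generalizing v with
  | nil =>
    refine Within.single ?_
    rw [cstep_cfg, prog, TM2.stepAux, update_inl]
    change some (TM2.stepAux _ (v.1, { v.2 with
      u := (outputStk M [] M.tm.k₁).head?.isSome
      acc := v.2.acc && ((outputStk M [] M.tm.k₁).head?.map fun y =>
        test (M.outputAlphabet y)).getD true }) (stks M (Function.update _ _
          (outputStk M [] M.tm.k₁).tail) _ _ _ _ _ _)) = _
    rw [outputStk_self, List.map_nil, List.tail_nil]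
    refine congrArg some ?_
    change TM2.stepAux (TM2.Stmt.push (Sum.inr Stk.res) (fun v => v.2.acc)
      (TM2.Stmt.load (fun v => (v.1, Reg.init)) TM2.Stmt.halt) : CStmt M) (v.1, { v.2 with
      u := false
      acc := v.2.acc && true }) _ = _
    rw [TM2.stepAux, update_res]
    have e := update_outputStk (M := M) [] []
    rw [List.map_nil] at e
    rw [e, outputStk_nil, ← hv]
    rfl
  | cons a y ih =>
    have h := ih (v.1, { v.2 with u := true, acc := v.2.acc && test a }) hv
    have e : (v.2.acc && (a :: y).all test) = ((v.2.acc && test a) && y.all test) := by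
      rw [List.all_cons, Bool.and_assoc]
    rw [e]
    refine Within.head ?_ h
    rw [cstep_cfg, prog, TM2.stepAux, update_inl]
    change some (TM2.stepAux _ (v.1, { v.2 with
      u := (outputStk M (a :: y) M.tm.k₁).head?.isSome
      acc := v.2.acc && ((outputStk M (a :: y) M.tm.k₁).head?.map fun y =>
        test (M.outputAlphabet y)).getD true }) (stks M (Function.update _ _
          (outputStk M (a :: y) M.tm.k₁).tail) _ _ _ _ _ _)) = _
    rw [outputStk_self, List.map_cons, List.tail_cons, update_outputStk, List.head?_cons]
    refine congrArg some ?_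
    change TM2.stepAux (jump M .post) (v.1, { v.2 with
      u := true
      acc := v.2.acc && test (M.outputAlphabet (M.outputAlphabet.symm a)) }) _ = _
    rw [Equiv.apply_symm_apply]
    rfl

/-- A transducer whose lists of items have length at most `B`, and which increments the counter at
most once for each symbol. -/
structure Transducer.Bounded (B : ℕ) : Prop where
  done_notMem : ∀ s p, .done ∉ P.items s p
  length_le : ∀ s p, (P.items s p).length ≤ B
  incs_le : ∀ s p, incs (P.items s p) ≤ 1

variable {P}

/-- `N` bounds the counter throughout, so each symbol costs at most `B` items of `2 * N + 4` steps
each, and four steps for reading, dispatching and leaving the loop. -/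
lemma within_main {B : ℕ} (hP : P.Bounded B) (x : List Sym) (N : ℕ) (hN : c + x.length + 1 ≤ N) :
    ∃ w n, w.1 = v.1 ∧ n ≤ N ∧
    Within (cstep P M test) ((x.length + 1) * (B * (2 * N + 4) + 4))
      (cfg M .main v S x [] c 0 o [])
      (cfg M .clear w S [] [] n 0 ((P.output x c v.2.pend).reverse ++ o) []) := by
  induction x generalizing c o v with
  | nil =>
    have hi := hP.incs_le none v.2.pend
    obtain ⟨w, hw, h⟩ := within_items P test S [] [.done] c o []
      (v.1, { v.2 with s := none }) (P.items none v.2.pend) (hP.done_notMem _ _) N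
      (by simp only [List.length_nil] at hN; omega)
    refine ⟨(w.1, { w.2 with t := some .done }), c + incs (P.items none v.2.pend), hw.1,
      by simp only [List.length_nil] at hN; omega, ?_⟩
    have h₁ : Within (cstep P M test) 2 (cfg M .main v S [] [] c 0 o [])
        (cfg M .exec (v.1, { v.2 with s := none }) S [] (P.items none v.2.pend ++ [.done])
          c 0 o []) := by
      refine Within.head (b := cfg M (.disp none v.2.pend) (v.1, { v.2 with s := none })
        S [] [] c 0 o []) ?_ (Within.single ?_)
      · rw [cstep_cfg, prog, TM2.stepAux, update_inp]
        rfl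
      · rw [cstep_cfg, prog, stepAux_pushItems, List.append_nil]
        rfl
    have h₂ := within_exec P test S [] [] (c + incs (P.items none v.2.pend)) 0
      ((emit c (P.items none v.2.pend)).reverse ++ o) [] w .done
    have h₃ : Within (cstep P M test) 1
      (cfg M (.item (some .done)) (w.1, { w.2 with t := some .done }) S [] []
        (c + incs (P.items none v.2.pend)) 0 ((emit c (P.items none v.2.pend)).reverse ++ o) [])
      (cfg M .clear (w.1, { w.2 with t := some .done }) S [] []
        (c + incs (P.items none v.2.pend)) 0 ((emit c (P.items none v.2.pend)).reverse ++ o) []) :=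
      Within.single rfl
    refine (((h₁.trans h).trans h₂).trans h₃).mono ?_
    have := Nat.mul_le_mul_right (2 * N + 4) (hP.length_le none v.2.pend)
    simp only [List.length_nil]
    omega
  | cons s x ih =>
    have hi := hP.incs_le (some s) v.2.pend
    simp only [List.length_cons] at hN ⊢
    set v₁ : M.tm.σ × Reg := (v.1, { v.2 with s := some s, pend := P.next s v.2.pend }) with hv₁
    obtain ⟨w, hw, h⟩ := within_items P test S x [] c o [] v₁
      (P.items (some s) v.2.pend) (hP.done_notMem _ _) N (by omega)
    obtain ⟨w', hw', h'⟩ := within_exec_nil P test S x (c + incs (P.items (some s) v.2.pend)) 0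
      ((emit c (P.items (some s) v.2.pend)).reverse ++ o) [] w
    obtain ⟨w'', n, hw'', hn, h''⟩ := ih (c + incs (P.items (some s) v.2.pend))
      ((emit c (P.items (some s) v.2.pend)).reverse ++ o) w' (by omega)
    refine ⟨w'', n, hw''.trans (hw.trans hw').1, hn, ?_⟩
    have h₁ : Within (cstep P M test) 2 (cfg M .main v S (s :: x) [] c 0 o [])
        (cfg M .exec v₁ S x (P.items (some s) v.2.pend ++ []) c 0 o []) := by
      refine Within.head (b := cfg M (.disp (some s) v.2.pend) (v.1, { v.2 with s := some s })
        S x [] c 0 o []) ?_ (Within.single ?_)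
      · rw [cstep_cfg, prog, TM2.stepAux, update_inp]
        rfl
      · rw [cstep_cfg, prog, TM2.stepAux, stepAux_pushItems]
        rfl
    have e : w'.2.pend = P.next s v.2.pend := (hw.trans hw').2.1
    rw [e] at h''
    have e' : (P.output (s :: x) c v.2.pend).reverse ++ o =
        (P.output x (c + incs (P.items (some s) v.2.pend)) (P.next s v.2.pend)).reverse ++
          ((emit c (P.items (some s) v.2.pend)).reverse ++ o) := by
      simp [Transducer.output]
    rw [e']
    refine (((h₁.trans h).trans h').trans h'').mono ?_
    have := Nat.mul_le_mul_right (2 * N + 4) (hP.length_le (some s) v.2.pend)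
    rw [Nat.succ_mul (x.length + 1)]
    omega

lemma length_emit_le (l : List Item) (N : ℕ) (hN : c + incs l ≤ N) :
    (emit c l).length ≤ l.length * (N + 1) := by
  induction l generalizing c with
  | nil => simp [emit]
  | cons a l ih =>
    rw [incs_cons] at hN
    rw [emit_cons, List.length_append, List.length_cons, Nat.succ_mul]
    have := ih (c + incs [a]) (by omega)
    have : (emit c [a]).length ≤ N + 1 := by
      cases a <;> simp [emit]
      omega
    omega

lemma length_output_le {B : ℕ} (hP : P.Bounded B) (x : List Sym) (p : Bool) (N : ℕ)
    (hN : c + x.length + 1 ≤ N) :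
    (P.output x c p).length ≤ (x.length + 1) * (B * (N + 1)) := by
  induction x generalizing c p with
  | nil =>
    have hi := hP.incs_le none p
    simp only [List.length_nil] at hN ⊢
    rw [Transducer.output, Nat.zero_add, Nat.one_mul]
    exact (length_emit_le _ _ N (by omega)).trans (Nat.mul_le_mul_right _ (hP.length_le _ _))
  | cons s x ih =>
    have hi := hP.incs_le (some s) p
    simp only [List.length_cons] at hN ⊢
    rw [Transducer.output, List.length_append, Nat.succ_mul (x.length + 1), Nat.add_comm]
    exact Nat.add_le_add (ih _ _ (by omega)) ((length_emit_le _ _ N (by omega)).trans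
      (Nat.mul_le_mul_right _ (hP.length_le _ _)))

/-- If the given machine maps the output of the transducer to `y`, then the composed machine tells
whether all symbols of `y` satisfy `test`. -/
theorem composed_outputs {B : ℕ} (hP : P.Bounded B) (x : List Sym) (y : List Γ₁) (m : ℕ)
    (h : Nonempty (TM2OutputsInTime M.tm ((P.output x 0 false).map M.inputAlphabet.invFun)
      (some (y.map M.outputAlphabet.invFun)) m)) :
    Nonempty (TM2OutputsInTime (composed P M test).tm
      (x.map (composed P M test).inputAlphabet.invFun)
      (some ([y.all test].map (composed P M test).outputAlphabet.invFun))
      (m + ((x.length + 1) * (B * (2 * (x.length + 1) + 4) + 4) + (x.length + 1 + 1) +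
        ((x.length + 1) * (B * (x.length + 1 + 1)) + 1) + (y.length + 1)))) := by
  obtain ⟨⟨⟨k, hk⟩, hkm⟩⟩ := h
  obtain ⟨w, n, hw, hn, h₁⟩ := within_main test (inputStk M []) 0 [] (M.tm.initialState, Reg.init)
    hP x (x.length + 1) (by omega)
  obtain ⟨w', hw', h₂⟩ := within_clear P test (inputStk M []) [] [] n 0
    ((P.output x 0 false).reverse ++ []) [] w
  have h₃ := within_move P test ((P.output x 0 false).reverse ++ []) w' [] (hw'.1.trans hw)
  have h₄ : Within (cstep P M test) m
      (embCfg M (initList M.tm ((P.output x 0 false).map M.inputAlphabet.symm)))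
      (embCfg M (haltList M.tm (y.map M.outputAlphabet.symm))) :=
    within_embCfg P test ⟨k, hkm, hk⟩
  have h₅ := within_post P test (M.tm.initialState, Reg.init) y rfl
  rw [List.append_nil, List.append_nil, List.reverse_reverse] at h₃
  rw [List.append_nil] at h₁ h₂
  have e₀ : initList (composed P M test).tm (x.map (composed P M test).inputAlphabet.invFun) =
      cfg M .main (M.tm.initialState, Reg.init) (inputStk M []) x [] 0 0 [] [] := by
    have hx : x.map (composed P M test).inputAlphabet.invFun = x := List.map_id x
    have hM : inputStk M [] = fun _ => [] := by simp [inputStk, stks_initList]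
    rw [hx, hM]
    have hs : (initList (composed P M test).tm x).stk = stks M (fun _ => []) x [] 0 0 [] [] := by
      funext k
      rcases k with k | k | k | k | k | k | k <;> rfl
    exact congrArg (fun S => (⟨some (.inr .main), (M.tm.initialState, Reg.init), S⟩ : CCfg M)) hs
  have e₁ : haltList (composed P M test).tm
      ([y.all test].map (composed P M test).outputAlphabet.invFun) =
      (⟨none, (M.tm.initialState, Reg.init),
        stks M (fun _ => []) [] [] 0 0 [] [y.all test]⟩ : CCfg M) := by
    have hs : (haltList (composed P M test).tm [y.all test]).stk =
        stks M (fun _ => []) [] [] 0 0 [] [y.all test] := by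
      funext k
      rcases k with k | k | k | k | k | k | k <;> rfl
    exact congrArg (fun S => (⟨none, (M.tm.initialState, Reg.init), S⟩ : CCfg M)) hs
  have hl := length_output_le 0 hP x false (x.length + 1) (by omega)
  obtain ⟨k', hk', e⟩ := ((((h₁.trans h₂).trans h₃).trans h₄).trans h₅)
  rw [← e₀] at e
  refine ⟨⟨⟨k', e.trans (congrArg some e₁.symm)⟩, hk'.trans ?_⟩⟩
  simp only [List.length_reverse]
  omega

end Machine

/-! ## The weighted 2-CNF that belongs to a CNF -/

/-- The variable that stands for a variable of the given CNF. -/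
def origVar (x : ℕ) : ℕ := 2 * x + 1

/-- The variables of the chains. -/
def chainVar (j : ℕ) : ℕ := 4 * 2 ^ j

/-- The variables that select a literal. -/
def selVar (j : ℕ) : ℕ := 4 * 2 ^ j + 2

/-- A clause, as a list of literals, and its weight. -/
abbrev Entry := List Literal × ℕ∞

/-- The clauses that belong to the beginning of a clause (`none`) or to an occurrence of a literal,
at a given position of the CNF. -/
def block (c : ℕ) : Option Literal → List Entry
  | none =>
    -- The chain restarts with the value true at the forced price `3 * 2 ^ c`, which lifts the
    -- potential from `2 ^ c` to `2 * 2 ^ (c + 1)`.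
    [([⟨chainVar (c + 1), true⟩], ⊤),
     ([⟨chainVar (c + 1), false⟩], (3 * 2 ^ c : ℕ))]
  | some l =>
    -- The hard clauses say that the chain never rises, and that selection forces a fall here and
    -- the literal to be true. The soft clauses charge `2 ^ c` for not selecting and `2 ^ c` for a
    -- chain that is still true.
    [([⟨chainVar (c + 1), false⟩, ⟨chainVar c, true⟩], ⊤),
     ([⟨selVar (c + 1), false⟩, ⟨chainVar c, true⟩], ⊤),
     ([⟨selVar (c + 1), false⟩, ⟨chainVar (c + 1), false⟩], ⊤),
     ([⟨selVar (c + 1), true⟩], (2 ^ c : ℕ)),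
     ([⟨chainVar (c + 1), false⟩], (2 ^ c : ℕ)),
     ([⟨selVar (c + 1), false⟩, ⟨origVar l.var, l.pos⟩], ⊤)]

/-- The clauses that belong to a sequence of beginnings of clauses and of literals, from the
position `c` on, and an empty clause. -/
def entries : ℕ → List (Option Literal) → List Entry
  -- The empty clause is always falsified. This constant shifts the possible optima into the range
  -- from `2 ^ (Q + 1) - 1` to `2 ^ (Q + 2) - 3`, in which only the least number consists of ones in
  -- binary.
  | c, [] => [([], (2 ^ c : ℕ))]
  | c, t :: ts => block c t ++ entries (c + 1) ts

/-- A list of clauses, as a sequence of beginnings of clauses and of literals. -/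
def tokens (L : List (List Literal)) : List (Option Literal) :=
  L.flatMap fun c => none :: c.map some

/-- The symbols that represent the beginning of a clause or a literal. -/
def encodeToken : Option Literal → List Sym
  | none => [.clause]
  | some l => encodeLiteral l

/-- The symbols that represent a clause and its weight. -/
def encodeEntry (p : Entry) : List Sym := encodeClause p.1 ++ .weight :: encodeWeight p.2

lemma tokens_cons (c : List Literal) (L : List (List Literal)) :
    tokens (c :: L) = none :: (c.map some ++ tokens L) := by
  simp [tokens]

lemma flatMap_encodeClause (L : List (List Literal)) :
    L.flatMap encodeClause = (tokens L).flatMap encodeToken := by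
  induction L with
  | nil => rfl
  | cons c L ih =>
    rw [List.flatMap_cons, ih, tokens_cons, List.flatMap_cons, List.flatMap_append,
      List.flatMap_map]
    rfl

/-! ### Binary representations -/

lemma bits_two_pow (j : ℕ) : (2 ^ j).bits = List.replicate j false ++ [true] := by
  induction j with
  | zero => simp
  | succ j ih =>
    rw [pow_succ', Nat.bit0_bits _ (by positivity), ih]
    rfl

lemma bits_three_mul_two_pow (j : ℕ) :
    (3 * 2 ^ j).bits = List.replicate j false ++ [true, true] := by
  induction j with
  | zero => rw [pow_zero, mul_one, (Nat.bit1_bits 1 : Nat.bits 3 = _)]; simp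
  | succ j ih =>
    rw [pow_succ', mul_left_comm, Nat.bit0_bits _ (by positivity), ih]
    rfl

lemma bits_two_pow_sub_one (j : ℕ) : (2 ^ j - 1).bits = List.replicate j true := by
  induction j with
  | zero => simp
  | succ j ih =>
    have h : 2 ^ (j + 1) - 1 = 2 * (2 ^ j - 1) + 1 := by
      have := Nat.one_le_two_pow (n := j)
      rw [pow_succ']; omega
    rw [h, Nat.bit1_bits, ih]
    rfl

lemma bits_chainVar (j : ℕ) :
    (chainVar j).bits = false :: false :: (List.replicate j false ++ [true]) := by
  rw [chainVar, (by ring : 4 * 2 ^ j = 2 * (2 * 2 ^ j)), Nat.bit0_bits _ (by positivity),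
    Nat.bit0_bits _ (by positivity), bits_two_pow]

lemma bits_selVar (j : ℕ) :
    (selVar j).bits = false :: true :: (List.replicate j false ++ [true]) := by
  rw [selVar, (by ring : 4 * 2 ^ j + 2 = 2 * (2 * 2 ^ j + 1)), Nat.bit0_bits _ (by positivity),
    Nat.bit1_bits, bits_two_pow]

lemma bits_origVar (x : ℕ) : (origVar x).bits = true :: x.bits := Nat.bit1_bits x

lemma bits_all_true {n : ℕ} (h : n.bits.all id = true) : ∃ j, n + 1 = 2 ^ j := by
  induction n using Nat.binaryRec' with
  | zero => exact ⟨0, rfl⟩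
  | bit b n hb ih =>
    rw [Nat.bits_append_bit _ _ hb, List.all_cons, Bool.and_eq_true] at h
    obtain ⟨rfl, h⟩ := h
    obtain ⟨j, hj⟩ := ih h
    refine ⟨j + 1, ?_⟩
    rw [pow_succ, ← hj]
    simp [Nat.bit]
    ring

lemma length_bits_le {n j : ℕ} (h : n < 2 ^ j) : n.bits.length ≤ j := by
  rw [Nat.size_eq_bits_len]
  exact Nat.size_le.2 h

/-! ### The transducer that writes it -/

/-- Items that write `2 ^ c`, where `c` is the value of the counter. -/
abbrev powItems : List Item := [.rep false, .sym (.bit true)]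

/-- Items that write the literal of `chainVar c`. -/
abbrev chainItems (s : Bool) : List Item :=
  [.sym (.lit s), .sym (.bit false), .sym (.bit false)] ++ powItems

/-- Items that write the literal of `chainVar (c + 1)`. -/
abbrev chainSuccItems (s : Bool) : List Item :=
  [.sym (.lit s), .sym (.bit false), .sym (.bit false), .sym (.bit false)] ++ powItems

/-- Items that write the literal of `selVar (c + 1)`. -/
abbrev selSuccItems (s : Bool) : List Item :=
  [.sym (.lit s), .sym (.bit false), .sym (.bit true), .sym (.bit false)] ++ powItems

/-- The end of a hard clause. -/
abbrev hardItems : List Item := [.sym .weight, .sym .infty]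

/-- Items that complete a clause that is not complete yet. -/
abbrev closeItems (p : Bool) : List Item := if p then hardItems else []

/-- The transducer that writes the weighted 2-CNF that belongs to a CNF, and the bound on its cost
if `dec` is true. -/
def reduction (dec : Bool) : Transducer where
  items
    | none, p => closeItems p ++ ([.sym .clause, .sym .weight] ++ powItems) ++
        -- At the end the counter is `Q`; `Q + 1` ones represent `2 ^ (Q + 1) - 1`.
        if dec then [.sym .bound, .rep true, .sym (.bit true)] else []
    | some (.bit b), _ => [.sym (.bit b)]
    -- The last clause ends with the literal being read: a leading 1 makes its variable odd, and its
    -- own bits are copied as they arrive. Its weight can only be written at the next token or at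
    -- the end, which is what the flag `p` remembers.
    | some (.lit s), p => closeItems p ++
        ([.sym .clause] ++ chainSuccItems false ++ chainItems true ++ hardItems) ++
        ([.sym .clause] ++ selSuccItems false ++ chainItems true ++ hardItems) ++
        ([.sym .clause] ++ selSuccItems false ++ chainSuccItems false ++ hardItems) ++
        ([.sym .clause] ++ selSuccItems true ++ [.sym .weight] ++ powItems) ++
        ([.sym .clause] ++ chainSuccItems false ++ [.sym .weight] ++ powItems) ++
        ([.sym .clause] ++ selSuccItems false ++ [.inc, .sym (.lit s), .sym (.bit true)])
    | some .clause, p => closeItems p ++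
        ([.sym .clause] ++ chainSuccItems true ++ hardItems) ++
        ([.sym .clause] ++ chainSuccItems false ++ [.sym .weight] ++ powItems ++
          -- A second 1 after `2 ^ c` turns it into `3 * 2 ^ c`.
          [.sym (.bit true), .inc])
    | some _, _ => []
  next
    | .lit _, _ => true
    | .clause, _ => false
    | _, p => p

lemma reduction_bounded (dec : Bool) : (reduction dec).Bounded 100 where
  done_notMem s p := by revert dec s p; decide
  length_le s p := by revert dec s p; decide
  incs_le s p := by revert dec s p; decide

lemma encodeWeight_natCast (n : ℕ) : encodeWeight (n : ℕ∞) = encodeNat n := by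
  simp [encodeWeight]

lemma encodeWeight_top : encodeWeight ⊤ = [.infty] := by simp [encodeWeight]

lemma encodeWeight_two_pow (c : ℕ) :
    encodeWeight (2 ^ c) = List.replicate c (.bit false) ++ [.bit true] := by
  have h := encodeWeight_natCast (2 ^ c)
  rw [encodeNat, bits_two_pow] at h
  simpa using h

lemma encodeWeight_three_mul_two_pow (c : ℕ) :
    encodeWeight (3 * 2 ^ c) = List.replicate c (.bit false) ++ [.bit true, .bit true] := by
  have h := encodeWeight_natCast (3 * 2 ^ c)
  rw [encodeNat, bits_three_mul_two_pow] at h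
  simpa using h

lemma output_bits (dec : Bool) (l : List Bool) (x : List Sym) (c : ℕ) :
    (reduction dec).output (l.map .bit ++ x) c true =
      l.map .bit ++ (reduction dec).output x c true := by
  induction l with
  | nil => rfl
  | cons b l ih =>
    rw [List.map_cons, List.cons_append, Transducer.output]
    have h : incs ((reduction dec).items (some (.bit b)) true) = 0 := rfl
    rw [h, Nat.add_zero]
    change emit c [.sym (.bit b)] ++ (reduction dec).output _ c true = _
    rw [ih]
    rfl

lemma output_tokens (dec : Bool) (ts : List (Option Literal)) (c : ℕ) (p : Bool) :
    (reduction dec).output (ts.flatMap encodeToken) c p =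
      emit c (closeItems p) ++ (entries c ts).flatMap encodeEntry ++
        if dec then .bound :: encodeNat (2 ^ (c + ts.length + 1) - 1) else [] := by
  induction ts generalizing c p with
  | nil =>
    cases p <;> cases dec <;>
      simp [Transducer.output, reduction, emit, entries, encodeEntry, encodeClause, closeItems,
        hardItems, powItems, encodeWeight_two_pow, encodeNat, bits_two_pow_sub_one,
        List.replicate_succ']
  | cons t ts ih =>
    have hl : c + (t :: ts).length + 1 = c + 1 + ts.length + 1 := by
      rw [List.length_cons]; omega
    rw [hl]
    cases t with
    | none =>
      rw [List.flatMap_cons, encodeToken, List.singleton_append, Transducer.output]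
      have h : incs ((reduction dec).items (some .clause) p) = 1 := by
        clear ih; revert dec p; decide
      have h' : (reduction dec).next .clause p = false := rfl
      rw [h, h', ih]
      cases p <;>
      simp [reduction, emit, entries, block, encodeEntry, encodeClause, encodeLiteral, closeItems,
        hardItems, powItems, chainItems, chainSuccItems, encodeWeight_three_mul_two_pow,
        encodeNat, bits_chainVar, encodeWeight_top, List.replicate_succ]
    | some l =>
      rw [List.flatMap_cons, encodeToken, encodeLiteral, List.cons_append, Transducer.output]
      have h : ∀ s, incs ((reduction dec).items (some (.lit s)) p) = 1 := by
        clear ih; revert dec p; decide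
      have h' : (reduction dec).next (.lit l.pos) p = true := rfl
      rw [h, h', encodeNat, output_bits, ih]
      cases p <;>
      simp [reduction, emit, entries, block, encodeEntry, encodeClause, encodeLiteral, closeItems,
        hardItems, powItems, chainItems, chainSuccItems, selSuccItems, encodeWeight_two_pow,
        encodeNat, bits_chainVar, bits_selVar, bits_origVar, encodeWeight_top,
        List.replicate_succ]

/-! ### The clauses are different -/

/-- The position to which a variable of the weighted 2-CNF belongs. -/
def varLevel (v : ℕ) : ℕ := if v % 2 = 1 then 0 else Nat.log 2 v - 2

/-- The position to which a clause of the weighted 2-CNF belongs. -/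
def level (C : Clause) : ℕ := C.sup fun l => varLevel l.var

lemma log_chainVar (j : ℕ) : Nat.log 2 (chainVar j) = j + 2 := by
  rw [chainVar, (by ring : 4 * 2 ^ j = 2 ^ (j + 2)), Nat.log_pow (by norm_num)]

lemma log_selVar (j : ℕ) : Nat.log 2 (selVar j) = j + 2 := by
  have := Nat.one_le_two_pow (n := j)
  refine Nat.log_eq_of_pow_le_of_lt_pow ?_ ?_ <;> rw [selVar] <;> ring_nf <;> omega

@[simp] lemma varLevel_chainVar (j : ℕ) : varLevel (chainVar j) = j := by
  rw [varLevel, log_chainVar, if_neg (by rw [chainVar]; omega), Nat.add_sub_cancel]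

@[simp] lemma varLevel_selVar (j : ℕ) : varLevel (selVar j) = j := by
  rw [varLevel, log_selVar, if_neg (by rw [selVar]; omega), Nat.add_sub_cancel]

@[simp] lemma varLevel_origVar (x : ℕ) : varLevel (origVar x) = 0 := by
  rw [varLevel, if_pos (by rw [origVar]; omega)]

@[simp] lemma chainVar_inj {i j : ℕ} : chainVar i = chainVar j ↔ i = j := by
  refine ⟨fun h => ?_, fun h => h ▸ rfl⟩
  simpa using congrArg varLevel h

@[simp] lemma chainVar_ne_selVar (i j : ℕ) : chainVar i ≠ selVar j := by
  rw [chainVar, selVar]; omega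

@[simp] lemma selVar_ne_chainVar (i j : ℕ) : selVar i ≠ chainVar j :=
  (chainVar_ne_selVar j i).symm

@[simp] lemma origVar_ne_selVar (i j : ℕ) : origVar i ≠ selVar j := by
  rw [origVar, selVar]; omega

@[simp] lemma origVar_ne_chainVar (i j : ℕ) : origVar i ≠ chainVar j := by
  rw [origVar, chainVar]; omega

@[simp] lemma selVar_ne_origVar (i j : ℕ) : selVar i ≠ origVar j := (origVar_ne_selVar j i).symm

@[simp] lemma chainVar_ne_origVar (i j : ℕ) : chainVar i ≠ origVar j :=
  (origVar_ne_chainVar j i).symm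

/-- Every clause of the block contains a chain or selecting variable of index `c + 1`, and none of a
larger index. -/
lemma level_of_mem_block {c : ℕ} {t : Option Literal} {p : Entry} (hp : p ∈ block c t) :
    level p.1.toFinset = c + 1 := by
  cases t <;> simp only [block, List.mem_cons, List.not_mem_nil, or_false] at hp
  · rcases hp with rfl | rfl <;> simp [level]
  · rcases hp with rfl | rfl | rfl | rfl | rfl | rfl <;> simp [level]

/-- The clause of an entry. -/
abbrev Entry.clause (p : Entry) : Clause := p.1.toFinset

lemma nodup_block (c : ℕ) (t : Option Literal) : ((block c t).map Entry.clause).Nodup := by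
  refine List.Nodup.of_map (fun C : Clause =>
    (decide (⟨selVar (c + 1), true⟩ ∈ C), decide (⟨selVar (c + 1), false⟩ ∈ C),
      decide (⟨chainVar c, true⟩ ∈ C), decide (⟨chainVar (c + 1), false⟩ ∈ C))) ?_
  cases t <;> simp [block]

lemma mem_entries {c : ℕ} {ts : List (Option Literal)} {p : Entry} : p ∈ entries c ts ↔
    (∃ i, ∃ h : i < ts.length, p ∈ block (c + i) ts[i]) ∨
      p = ([], ((2 ^ (c + ts.length) : ℕ) : ℕ∞)) := by
  induction ts generalizing c with
  | nil => simp [entries]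
  | cons t ts ih =>
    rw [entries, List.mem_append, ih, ← or_assoc]
    refine or_congr ⟨?_, ?_⟩ ?_
    · rintro (h | ⟨i, hi, h⟩)
      · exact ⟨0, by simp, by simpa using h⟩
      · refine ⟨i + 1, by simpa using hi, ?_⟩
        rwa [List.getElem_cons_succ, ← Nat.add_assoc, Nat.add_right_comm]
    · rintro ⟨i, hi, h⟩
      cases i with
      | zero => exact Or.inl (by simpa using h)
      | succ i =>
        refine Or.inr ⟨i, by simpa using hi, ?_⟩
        rwa [List.getElem_cons_succ, ← Nat.add_assoc, Nat.add_right_comm] at h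
    · rw [List.length_cons, Nat.add_right_comm, Nat.add_assoc]

/-- A formula is a set with a weight function, so equal clauses would lose weight. Different blocks
have different positive levels, and the empty clause has level 0. -/
lemma nodup_entries (c : ℕ) (ts : List (Option Literal)) :
    ((entries c ts).map Entry.clause).Nodup := by
  induction ts generalizing c with
  | nil => simp [entries]
  | cons t ts ih =>
    rw [entries, List.map_append]
    refine (nodup_block c t).append (ih (c + 1)) ?_
    intro C h h'
    obtain ⟨p, hp, rfl⟩ := List.mem_map.1 h
    obtain ⟨q, hq, e⟩ := List.mem_map.1 h'
    have hl := level_of_mem_block hp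
    rcases mem_entries.1 hq with ⟨i, hi, hq⟩ | rfl
    · have hl' := level_of_mem_block hq
      change level p.clause = _ at hl
      rw [← e] at hl
      change level q.clause = _ at hl'
      omega
    · change level p.clause = _ at hl
      rw [← e] at hl
      simp [level, Entry.clause] at hl

lemma length_le_two {c : ℕ} {ts : List (Option Literal)} {p : Entry} (hp : p ∈ entries c ts) :
    p.1.length ≤ 2 := by
  rcases mem_entries.1 hp with ⟨i, hi, hp⟩ | rfl
  · cases ht : ts[i] <;> simp only [ht, block, List.mem_cons, List.not_mem_nil, or_false] at hp
    · rcases hp with rfl | rfl <;> simp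
    · rcases hp with rfl | rfl | rfl | rfl | rfl | rfl <;> simp
  · simp

lemma nodup_of_mem_entries {c : ℕ} {ts : List (Option Literal)} {p : Entry}
    (hp : p ∈ entries c ts) : p.1.Nodup := by
  rcases mem_entries.1 hp with ⟨i, hi, hp⟩ | rfl
  · cases ht : ts[i] <;> simp only [ht, block, List.mem_cons, List.not_mem_nil, or_false] at hp
    · rcases hp with rfl | rfl <;> simp
    · rcases hp with rfl | rfl | rfl | rfl | rfl | rfl <;> simp
  · simp

open Classical in
/-- The weighted CNF given by a list of clauses and weights. -/
def wcnfOfEntries (E : List Entry) : WCNF where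
  clauses := (E.map Entry.clause).toFinset
  weight C := if h : ∃ p ∈ E, p.clause = C then h.choose.2 else 0

lemma weight_wcnfOfEntries {E : List Entry} (hE : (E.map Entry.clause).Nodup) {p : Entry}
    (hp : p ∈ E) : (wcnfOfEntries E).weight p.clause = p.2 := by
  have h : ∃ q ∈ E, q.clause = p.clause := ⟨p, hp, rfl⟩
  change dite _ _ _ = _
  rw [dif_pos h, List.inj_on_of_nodup_map hE h.choose_spec.1 hp h.choose_spec.2]

/-- The weighted 2-CNF that belongs to a sequence of beginnings of clauses and of literals. -/
def reduct (ts : List (Option Literal)) : WCNFInput where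
  formula := wcnfOfEntries (entries 0 ts)
  list := (entries 0 ts).map Prod.fst
  isListing :=
    { literals_nodup := by
        intro l hl
        obtain ⟨p, hp, rfl⟩ := List.mem_map.1 hl
        exact nodup_of_mem_entries hp
      clauses_nodup := by
        rw [List.map_map]
        exact nodup_entries 0 ts
      clauses_eq := by
        rw [List.map_map]
        rfl }

lemma mem_clauses_reduct {ts : List (Option Literal)} {C : Clause} :
    C ∈ (reduct ts).formula.clauses ↔ ∃ p ∈ entries 0 ts, p.clause = C := by
  change C ∈ ((entries 0 ts).map Entry.clause).toFinset ↔ _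
  rw [List.mem_toFinset, List.mem_map]

lemma reduct_isWidth (ts : List (Option Literal)) : (reduct ts).formula.clauses.IsWidth 2 := by
  intro C hC
  obtain ⟨p, hp, rfl⟩ := mem_clauses_reduct.1 hC
  exact (List.toFinset_card_le _).trans (length_le_two hp)

lemma encode_reduct (ts : List (Option Literal)) :
    (reduct ts).encode = (entries 0 ts).flatMap encodeEntry := by
  change ((entries 0 ts).map Prod.fst).flatMap _ = _
  rw [List.flatMap_map]
  refine List.flatMap_congr fun p hp => ?_
  change _ ++ _ :: encodeWeight ((wcnfOfEntries (entries 0 ts)).weight (Entry.clause p)) = _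
  rw [weight_wcnfOfEntries (nodup_entries 0 ts) hp]
  rfl

/-! ### The cost -/

/-- The weight of an entry, if its clause is falsified. -/
def entryCost (β : ℕ → Bool) (p : Entry) : ℕ∞ :=
  if p.1.any fun l => β l.var == l.pos then 0 else p.2

/-- The total weight of the falsified clauses of a list. -/
def listCost (β : ℕ → Bool) (E : List Entry) : ℕ∞ := (E.map (entryCost β)).sum

lemma listCost_append (β : ℕ → Bool) (E E' : List Entry) :
    listCost β (E ++ E') = listCost β E + listCost β E' := by
  simp [listCost]

lemma costOf_wcnfOfEntries {E : List Entry} (hE : (E.map Entry.clause).Nodup) (β : ℕ → Bool) :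
    (wcnfOfEntries E).costOf β = listCost β E := by
  classical
  rw [WCNF.costOf, Finset.sum_filter]
  change ∑ C ∈ (E.map Entry.clause).toFinset, _ = _
  rw [List.sum_toFinset _ hE, List.map_map, listCost]
  refine congrArg List.sum (List.map_congr_left fun p hp => ?_)
  rw [Function.comp, weight_wcnfOfEntries hE hp, entryCost]
  have : Satisfies β (Entry.clause p) ↔ (p.1.any fun l => β l.var == l.pos) = true := by
    simp [Satisfies]
  by_cases h : Satisfies β (Entry.clause p)
  · rw [if_neg (not_not.2 h), if_pos (this.1 h)]
  · rw [if_pos h, if_neg (this.not.1 h)]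

lemma costOf_reduct (ts : List (Option Literal)) (β : ℕ → Bool) :
    (reduct ts).formula.costOf β = listCost β (entries 0 ts) :=
  costOf_wcnfOfEntries (nodup_entries 0 ts) β

lemma listCost_block_none (β : ℕ → Bool) (c : ℕ) : listCost β (block c none) =
    if β (chainVar (c + 1)) then 3 * 2 ^ c else ⊤ := by
  cases h : β (chainVar (c + 1)) <;> simp [listCost, block, entryCost, h]

/-- The cost of the block of a literal, given the values of the variables that occur in it. -/
def litCost (c : ℕ) : Bool → Bool → Bool → Bool → ℕ∞
  | false, false, false, _ => 2 ^ c
  | true, false, false, _ => 2 ^ c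
  | true, true, false, _ => 2 ^ c + 2 ^ c
  | true, false, true, true => 0
  | _, _, _, _ => ⊤

lemma listCost_block_some (β : ℕ → Bool) (c : ℕ) (l : Literal) : listCost β (block c (some l)) =
    litCost c (β (chainVar c)) (β (chainVar (c + 1))) (β (selVar (c + 1)))
      (β (origVar l.var) == l.pos) := by
  cases h : β (chainVar (c + 1)) <;> cases h' : β (chainVar c) <;>
    cases h'' : β (selVar (c + 1)) <;> cases h''' : (β (origVar l.var) == l.pos) <;>
    simp_all [listCost, block, entryCost, litCost]

/-! ### Lower bounds for the cost -/

/-- The value of a literal, if `β` is an assignment of the weighted 2-CNF. -/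
def litVal (β : ℕ → Bool) (l : Literal) : Bool := β (origVar l.var) == l.pos

lemma listCost_entries_cons (β : ℕ → Bool) (c : ℕ) (t : Option Literal)
    (ts : List (Option Literal)) : listCost β (entries c (t :: ts)) =
      listCost β (block c t) + listCost β (entries (c + 1) ts) := by
  rw [entries, listCost_append]

/-- A false chain stays false without selecting, at price `2 ^ c` in each step, so the potential
doubles exactly. -/
lemma le_listCost_of_chainVar_false (β : ℕ → Bool) (ls : List Literal) (c : ℕ)
    (ts : List (Option Literal)) (h : β (chainVar c) = false) :
    listCost β (entries (c + ls.length) ts) + 2 ^ (c + ls.length) ≤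
      listCost β (entries c (ls.map some ++ ts)) + 2 ^ c := by
  induction ls generalizing c with
  | nil => exact le_rfl
  | cons l ls ih =>
    rw [List.map_cons, List.cons_append, listCost_entries_cons, listCost_block_some, h]
    cases hZ : β (chainVar (c + 1)) <;> cases hY : β (selVar (c + 1)) <;>
      simp only [litCost, top_add, le_top]
    have := ih (c + 1) hZ
    rw [List.length_cons, Nat.add_comm ls.length, ← Nat.add_assoc]
    refine this.trans (le_of_eq ?_)
    ring

/-- The potential of a true chain is `2 ^ (c + 1)`. Staying true doubles it; a fall leaves at least
the potential of a false chain at `c + 1`. -/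
lemma le_listCost_of_chainVar_true (β : ℕ → Bool) (ls : List Literal) (c : ℕ)
    (ts : List (Option Literal)) (h : β (chainVar c) = true) :
    listCost β (entries (c + ls.length) ts) + 2 ^ (c + ls.length) ≤
      listCost β (entries c (ls.map some ++ ts)) + 2 ^ (c + 1) := by
  induction ls generalizing c with
  | nil =>
    -- The clause has ended without a fall: this is where the bound has slack.
    refine add_le_add le_rfl ?_
    rw [List.length_nil, Nat.add_zero, pow_succ, mul_two]
    exact le_self_add
  | cons l ls ih =>
    rw [List.map_cons, List.cons_append, listCost_entries_cons, listCost_block_some, h,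
      List.length_cons, Nat.add_comm ls.length, ← Nat.add_assoc]
    cases hZ : β (chainVar (c + 1)) <;> cases hY : β (selVar (c + 1)) <;>
      cases hl : (β (origVar l.var) == l.pos) <;> simp only [litCost, top_add, le_top]
    · refine (le_listCost_of_chainVar_false β ls (c + 1) ts hZ).trans ?_
      exact add_le_add le_add_self le_rfl
    · refine (le_listCost_of_chainVar_false β ls (c + 1) ts hZ).trans ?_
      exact add_le_add le_add_self le_rfl
    · refine (le_listCost_of_chainVar_false β ls (c + 1) ts hZ).trans ?_
      exact add_le_add le_add_self le_rfl
    all_goals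
      refine (ih (c + 1) hZ).trans (le_of_eq ?_)
      ring

/-- If a literal is false, its block costs at least `2 ^ c` whatever the chain does. Starting from
`2 ^ c` therefore suffices, half of what a true chain provides. -/
lemma le_listCost_of_falsified (β : ℕ → Bool) (ls : List Literal) (c : ℕ)
    (ts : List (Option Literal)) (hl : ∀ l ∈ ls, litVal β l = false) :
    listCost β (entries (c + ls.length) ts) + 2 ^ (c + ls.length) ≤
      listCost β (entries c (ls.map some ++ ts)) + 2 ^ c := by
  induction ls generalizing c with
  | nil => exact le_rfl
  | cons l ls ih =>
    have hl₀ : (β (origVar l.var) == l.pos) = false := hl l (by simp)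
    have := ih (c + 1) fun m hm => hl m (by simp [hm])
    rw [List.map_cons, List.cons_append, listCost_entries_cons, listCost_block_some, hl₀,
      List.length_cons, Nat.add_comm ls.length, ← Nat.add_assoc]
    refine this.trans ?_
    have key : ∀ z z' y, (2 : ℕ∞) ^ c ≤ litCost c z z' y false := by
      intro z z' y
      cases z <;> cases z' <;> cases y <;> simp [litCost]
    calc listCost β (entries (c + 1) (ls.map some ++ ts)) + 2 ^ (c + 1)
        = 2 ^ c + listCost β (entries (c + 1) (ls.map some ++ ts)) + 2 ^ c := by ring
      _ ≤ _ := by gcongr; exact key ..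

lemma le_listCost_tokens (β : ℕ → Bool) (L : List (List Literal)) (c : ℕ) :
    2 ^ (c + (tokens L).length + 1) ≤ listCost β (entries c (tokens L)) + 2 ^ c := by
  induction L generalizing c with
  | nil => simp [tokens, entries, listCost, entryCost, pow_succ, mul_two]
  | cons ls L ih =>
    rw [tokens_cons, listCost_entries_cons, listCost_block_none]
    cases h : β (chainVar (c + 1))
    · simp
    · have h₁ := le_listCost_of_chainVar_true β ls (c + 1) (tokens L) h
      have h₂ := ih (c + 1 + ls.length)
      have e : c + (none :: (ls.map some ++ tokens L)).length + 1 =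
          c + 1 + ls.length + (tokens L).length + 1 := by
        simp; ring
      rw [e]
      refine (h₂.trans h₁).trans (le_of_eq ?_)
      rw [if_pos rfl]
      ring

/-- The falsified clause starts with potential `2 * 2 ^ (c + 1)`, of which
`le_listCost_of_falsified` uses only one half; the other half is a surplus of at least 1. -/
lemma lt_listCost_tokens (β : ℕ → Bool) (L : List (List Literal)) (c : ℕ) (ls : List Literal)
    (hls : ls ∈ L) (hf : ∀ l ∈ ls, litVal β l = false) :
    2 ^ (c + (tokens L).length + 1) + 1 ≤ listCost β (entries c (tokens L)) + 2 ^ c := by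
  induction L generalizing c with
  | nil => simp at hls
  | cons ks L ih =>
    have e : c + (none :: (ks.map some ++ tokens L)).length + 1 =
        c + 1 + ks.length + (tokens L).length + 1 := by
      simp; ring
    rw [tokens_cons, listCost_entries_cons, listCost_block_none, e]
    cases h : β (chainVar (c + 1))
    · simp
    · rw [if_pos rfl]
      rcases List.mem_cons.1 hls with rfl | hls
      · have h₁ := le_listCost_of_falsified β ls (c + 1) (tokens L) hf
        have h₂ := (le_listCost_tokens β L (c + 1 + ls.length)).trans h₁
        calc (2 : ℕ∞) ^ (c + 1 + ls.length + (tokens L).length + 1) + 1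
            ≤ listCost β (entries (c + 1) (ls.map some ++ tokens L)) + 2 ^ (c + 1) +
              2 ^ (c + 1) := by
              gcongr
              exact_mod_cast Nat.one_le_two_pow
          _ = _ := by ring
      · have h₁ := le_listCost_of_chainVar_true β ks (c + 1) (tokens L) h
        refine ((ih (c + 1 + ks.length) hls).trans h₁).trans (le_of_eq ?_)
        ring

/-! ### Upper bounds for the cost -/

/-- The value of the next variable of a chain: whether no literal of the clause has been true so
far. -/
def nextVal (β : ℕ → Bool) (b : Bool) : Option Literal → Bool
  | none => true
  | some l => b && !litVal β l

/-- The assignment `β` selects the first true literal of each clause. -/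
def Selects (β : ℕ → Bool) : ℕ → List (Option Literal) → Bool → Prop
  | c, [], b => β (chainVar c) = b
  | c, t :: ts, b => β (chainVar c) = b ∧
      (∀ l, t = some l → β (selVar (c + 1)) = (b && litVal β l)) ∧
      Selects β (c + 1) ts (nextVal β b t)

lemma Selects.chainVar_eq {β : ℕ → Bool} {c : ℕ} {ts : List (Option Literal)} {b : Bool}
    (h : Selects β c ts b) : β (chainVar c) = b := by
  cases ts with
  | nil => exact h
  | cons t ts => exact h.1

/-- No block costs more than `3 * 2 ^ c`, even if clauses are falsified, and these bounds telescope.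
This gives finiteness and the upper end of the range of the optimum. -/
lemma Selects.listCost_le {β : ℕ → Bool} {c : ℕ} {ts : List (Option Literal)} {b : Bool}
    (h : Selects β c ts b) :
    listCost β (entries c ts) + 3 * 2 ^ c ≤ 4 * 2 ^ (c + ts.length) := by
  induction ts generalizing c b with
  | nil =>
    refine le_of_eq ?_
    simp [entries, listCost, entryCost]
    ring
  | cons t ts ih =>
    have ih' := ih h.2.2
    rw [listCost_entries_cons, List.length_cons, Nat.add_comm ts.length, ← Nat.add_assoc]
    have key : listCost β (block c t) ≤ 3 * 2 ^ c := by
      cases t with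
      | none => rw [listCost_block_none, h.2.2.chainVar_eq]; rfl
      | some l =>
        rw [listCost_block_some, h.1, h.2.2.chainVar_eq, h.2.1 l rfl, nextVal, litVal]
        have h₁ : (2 : ℕ∞) ^ c ≤ 3 * 2 ^ c := by
          calc (2 : ℕ∞) ^ c = 1 * 2 ^ c := (one_mul _).symm
            _ ≤ _ := by gcongr; norm_num
        have h₂ : (2 : ℕ∞) ^ c + 2 ^ c ≤ 3 * 2 ^ c := by
          calc (2 : ℕ∞) ^ c + 2 ^ c = 2 * 2 ^ c := (two_mul _).symm
            _ ≤ _ := by gcongr; norm_num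
        cases b <;> cases (β (origVar l.var) == l.pos) <;> simp [litCost, h₁, h₂]
    refine le_trans ?_ ih'
    calc listCost β (block c t) + listCost β (entries (c + 1) ts) + 3 * 2 ^ c
        ≤ 3 * 2 ^ c + listCost β (entries (c + 1) ts) + 3 * 2 ^ c := by gcongr
      _ = _ := by ring

lemma Selects.listCost_le_of_false {β : ℕ → Bool} {c : ℕ} {ls : List Literal}
    {ts : List (Option Literal)} (h : Selects β c (ls.map some ++ ts) false) :
    Selects β (c + ls.length) ts false ∧
    listCost β (entries c (ls.map some ++ ts)) + 2 ^ c ≤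
      listCost β (entries (c + ls.length) ts) + 2 ^ (c + ls.length) := by
  induction ls generalizing c with
  | nil => exact ⟨h, le_rfl⟩
  | cons l ls ih =>
    obtain ⟨h₀, h₁, h₂⟩ := h
    obtain ⟨ih₁, ih₂⟩ := ih h₂
    rw [List.map_cons, List.cons_append, listCost_entries_cons, listCost_block_some,
      List.length_cons, Nat.add_comm ls.length, ← Nat.add_assoc, h₀, h₂.chainVar_eq, h₁ l rfl]
    refine ⟨ih₁, le_trans (le_of_eq ?_) ih₂⟩
    simp only [nextVal, Bool.false_and, litCost]
    ring

/-- The chain stays true up to the first true literal, falls there with selection, and then stays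
false; the potential is met exactly in all three phases. -/
lemma Selects.listCost_le_of_true {β : ℕ → Bool} {c : ℕ} {ls : List Literal}
    {ts : List (Option Literal)} (h : Selects β c (ls.map some ++ ts) true)
    (hl : ∃ l ∈ ls, litVal β l = true) :
    Selects β (c + ls.length) ts false ∧
    listCost β (entries c (ls.map some ++ ts)) + 2 ^ (c + 1) ≤
      listCost β (entries (c + ls.length) ts) + 2 ^ (c + ls.length) := by
  induction ls generalizing c with
  | nil => simp at hl
  | cons l ls ih =>
    obtain ⟨h₀, h₁, h₂⟩ := h
    rw [List.map_cons, List.cons_append, listCost_entries_cons, listCost_block_some,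
      List.length_cons, Nat.add_comm ls.length, ← Nat.add_assoc, h₀, h₂.chainVar_eq, h₁ l rfl]
    cases hv : litVal β l with
    | true =>
      simp only [nextVal, hv, Bool.not_true, Bool.and_false] at h₂ ⊢
      obtain ⟨ih₁, ih₂⟩ := h₂.listCost_le_of_false
      refine ⟨ih₁, le_trans (le_of_eq ?_) ih₂⟩
      rw [litVal] at hv
      rw [hv]
      simp [litCost]
    | false =>
      simp only [nextVal, hv, Bool.not_false, Bool.and_true] at h₂ ⊢
      obtain ⟨m, hm, hm'⟩ := hl
      have hm : m ∈ ls := by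
        rcases List.mem_cons.1 hm with rfl | hm
        · simp [hv] at hm'
        · exact hm
      obtain ⟨ih₁, ih₂⟩ := ih h₂ ⟨m, hm, hm'⟩
      refine ⟨ih₁, le_trans (le_of_eq ?_) ih₂⟩
      change 2 ^ c + 2 ^ c + _ + _ = _
      ring

lemma Selects.listCost_tokens_le {β : ℕ → Bool} {c : ℕ} {L : List (List Literal)} {b : Bool}
    (h : Selects β c (tokens L) b) (hL : ∀ ls ∈ L, ∃ l ∈ ls, litVal β l = true) :
    listCost β (entries c (tokens L)) + 2 ^ c ≤ 2 ^ (c + (tokens L).length + 1) := by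
  induction L generalizing c b with
  | nil => simp [tokens, entries, listCost, entryCost, pow_succ, mul_two]
  | cons ls L ih =>
    rw [tokens_cons] at h
    obtain ⟨h₀, h₁, h₂⟩ := h
    obtain ⟨h₃, h₄⟩ := h₂.listCost_le_of_true (hL ls (by simp))
    have h₅ := ih h₃ fun ks hks => hL ks (by simp [hks])
    have e : c + (none :: (ls.map some ++ tokens L)).length + 1 =
        c + 1 + ls.length + (tokens L).length + 1 := by
      simp; ring
    rw [tokens_cons, listCost_entries_cons, listCost_block_none, h₂.chainVar_eq, nextVal,
      if_pos rfl, e]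
    refine le_trans (le_of_eq ?_) (h₄.trans h₅)
    ring

/-- The assignment composed of an assignment of the given CNF, and of values of the variables of the
chains and of the selecting variables. -/
def glue (α z y : ℕ → Bool) (v : ℕ) : Bool :=
  if v % 2 = 1 then α (v / 2) else if v % 4 = 0 then z (varLevel v) else y (varLevel v)

@[simp] lemma glue_origVar (α z y : ℕ → Bool) (x : ℕ) : glue α z y (origVar x) = α x := by
  rw [glue, if_pos (by rw [origVar]; omega), origVar]
  congr 1
  omega

@[simp] lemma glue_chainVar (α z y : ℕ → Bool) (j : ℕ) : glue α z y (chainVar j) = z j := by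
  rw [glue, if_neg (by rw [chainVar]; omega), if_pos (by rw [chainVar]; omega), varLevel_chainVar]

@[simp] lemma glue_selVar (α z y : ℕ → Bool) (j : ℕ) : glue α z y (selVar j) = y j := by
  rw [glue, if_neg (by rw [selVar]; omega), if_neg (by rw [selVar]; omega), varLevel_selVar]

lemma exists_selects (α : ℕ → Bool) (ts : List (Option Literal)) :
    ∃ β : ℕ → Bool, (∀ x, β (origVar x) = α x) ∧ Selects β 0 ts false := by
  -- The chain values have to be defined before the glued assignment exists; `γ` agrees with it on
  -- the odd variables, the only ones that `litVal` looks at.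
  set γ : ℕ → Bool := fun v => α (v / 2) with hγ
  set z : ℕ → Bool := fun j => (ts.take j).foldl (nextVal γ) false with hz
  set y : ℕ → Bool := fun j => z (j - 1) && ((ts[j - 1]?).join.map (litVal γ)).getD false with hy
  have hα : ∀ l, litVal (glue α z y) l = litVal γ l := by
    intro l
    rw [litVal, litVal, glue_origVar, hγ]
    have : origVar l.var / 2 = l.var := by rw [origVar]; omega
    simp only [this]
  refine ⟨glue α z y, glue_origVar α z y, ?_⟩
  suffices h : ∀ pre suf, ts = pre ++ suf →
      Selects (glue α z y) pre.length suf (pre.foldl (nextVal γ) false) from h [] ts rfl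
  intro pre suf hts
  induction suf generalizing pre with
  | nil => simp [Selects, hz, hts]
  | cons t suf ih =>
    refine ⟨by simp [hz, hts], ?_, ?_⟩
    · rintro l rfl
      rw [glue_selVar, hα]
      simp [hy, hz, hts]
    · have := ih (pre ++ [t]) (by simp [hts])
      rw [List.length_append, List.foldl_append] at this
      have e : nextVal (glue α z y) (pre.foldl (nextVal γ) false) t =
          nextVal γ (pre.foldl (nextVal γ) false) t := by
        cases t with
        | none => rfl
        | some l => rw [nextVal, nextVal, hα]
      rw [e]
      exact this

/-! ### The cost of the weighted 2-CNF -/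

/-- The cost of the weighted 2-CNF that belongs to a CNF. -/
theorem cost_reduct {φ : CNF} {L : List (List Literal)} (hL : IsListing L φ) :
    ∃ n : ℕ, (reduct (tokens L)).formula.cost = n ∧ 2 ^ ((tokens L).length + 1) ≤ n + 1 ∧
      n + 3 ≤ 2 ^ ((tokens L).length + 2) ∧
      (φ.Satisfiable ↔ n + 1 = 2 ^ ((tokens L).length + 1)) := by
  set Q := (tokens L).length with hQ
  have hφ : ∀ C, C ∈ φ ↔ ∃ ls ∈ L, ls.toFinset = C := by
    intro C
    rw [← hL.clauses_eq, List.mem_toFinset, List.mem_map]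
  have hle : ∀ β, (reduct (tokens L)).formula.cost ≤ listCost β (entries 0 (tokens L)) := by
    intro β
    rw [← costOf_reduct]
    exact iInf_le _ β
  -- The infimum is attained, so lower bounds for a single assignment apply to the optimum.
  obtain ⟨β, hβ⟩ := ENat.exists_eq_iInf fun β => (reduct (tokens L)).formula.costOf β
  change _ = (reduct (tokens L)).formula.cost at hβ
  rw [costOf_reduct] at hβ
  -- Any assignment of the original variables would do here: only the crude upper bound is needed.
  obtain ⟨β₀, -, hβ₀⟩ := exists_selects (fun _ => true) (tokens L)
  have h₁ := le_listCost_tokens β L 0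
  have h₂ := (add_le_add_left (hle β₀) _).trans hβ₀.listCost_le
  rw [hβ, Nat.zero_add, pow_zero] at h₁
  rw [Nat.zero_add, pow_zero, mul_one] at h₂
  have hfin : (reduct (tokens L)).formula.cost ≠ ⊤ := by
    intro h
    rw [h, top_add, top_le_iff] at h₂
    have : ((4 * 2 ^ Q : ℕ) : ℕ∞) = ⊤ := by exact_mod_cast h₂
    exact ENat.natCast_ne_top _ this
  obtain ⟨n, hn⟩ := ENat.ne_top_iff_exists.1 hfin
  rw [← hn] at h₁ h₂ hβ
  have h₁ : 2 ^ (Q + 1) ≤ n + 1 := by exact_mod_cast h₁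
  have h₂ : n + 3 ≤ 4 * 2 ^ Q := by exact_mod_cast h₂
  refine ⟨n, hn.symm, h₁, h₂.trans (le_of_eq (by ring)), ?_, ?_⟩
  · rintro ⟨α, hα⟩
    obtain ⟨β₁, hα₁, hβ₁⟩ := exists_selects α (tokens L)
    have h := hβ₁.listCost_tokens_le fun ls hls => by
      obtain ⟨l, hl, e⟩ := hα _ ((hφ _).2 ⟨ls, hls, rfl⟩)
      exact ⟨l, List.mem_toFinset.1 hl, by simp [litVal, hα₁, e]⟩
    have h := (add_le_add_left (hle β₁) _).trans h
    rw [Nat.zero_add, pow_zero, ← hn] at h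
    have h : n + 1 ≤ 2 ^ (Q + 1) := by exact_mod_cast h
    exact le_antisymm h h₁
  · intro h
    by_contra hs
    have : ∃ ls ∈ L, ∀ l ∈ ls, litVal β l = false := by
      by_contra! hc
      refine hs ⟨fun x => β (origVar x), fun C hC => ?_⟩
      obtain ⟨ls, hls, rfl⟩ := (hφ C).1 hC
      obtain ⟨l, hl, e⟩ := hc ls hls
      exact ⟨l, List.mem_toFinset.2 hl, by simpa [litVal] using e⟩
    obtain ⟨ls, hls, hf⟩ := this
    have h' := lt_listCost_tokens β L 0 ls hls hf
    rw [hβ, Nat.zero_add, pow_zero] at h'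
    have h' : 2 ^ (Q + 1) + 1 ≤ n + 1 := by exact_mod_cast h'
    omega

/-! ## Treewidth -/

/-- A connected graph with one edge less than vertices is a tree; the edges correspond to the pairs
of consecutive positions. -/
lemma isTree_pathGraph (n : ℕ) : (SimpleGraph.pathGraph (n + 1)).IsTree := by
  rw [SimpleGraph.isTree_iff_connected_and_card]
  refine ⟨SimpleGraph.pathGraph_connected n, ?_⟩
  have hadj : ∀ i : Fin n, (SimpleGraph.pathGraph (n + 1)).Adj i.castSucc i.succ := fun i => by
    simp [SimpleGraph.pathGraph_adj]
  have hb : Function.Bijective fun i : Fin n =>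
      (⟨s(i.castSucc, i.succ), hadj i⟩ : (SimpleGraph.pathGraph (n + 1)).edgeSet) := by
    constructor
    · intro i j h
      have h := congrArg Subtype.val h
      simp only [Sym2.eq_iff, Fin.ext_iff, Fin.val_castSucc, Fin.val_succ] at h
      ext
      omega
    · rintro ⟨e, he⟩
      induction e using Sym2.inductionOn with
      | hf u v =>
        rw [SimpleGraph.mem_edgeSet, SimpleGraph.pathGraph_adj] at he
        rcases he with he | he
        · refine ⟨⟨u, by omega⟩, Subtype.ext (Sym2.eq_iff.2 (Or.inl ⟨?_, ?_⟩))⟩ <;>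
            simp [he]
        · refine ⟨⟨v, by omega⟩, Subtype.ext (Sym2.eq_iff.2 (Or.inr ⟨?_, ?_⟩))⟩ <;>
            simp [he]
  rw [← Nat.card_congr (Equiv.ofBijective _ hb), Nat.card_fin, Nat.card_fin]

section

variable {V : Type} [Fintype V] (G : SimpleGraph V) (S : Finset V) (h : V → ℕ)

open Classical in
/-- The path decomposition given by a set of vertices that occur in all bags, and a linear
arrangement of the other ones, in which only neighbouring levels are adjacent. -/
def levelDecomposition (hadj : ∀ u v, G.Adj u v → u ∈ S ∨ v ∈ S ∨ h u ≤ h v + 1) :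
    TreeDecomposition G where
  size := Finset.univ.sup h + 1
  tree := SimpleGraph.pathGraph _
  isTree := isTree_pathGraph _
  -- A vertex outside of `S` occurs in at most two bags, which are neighbours on the path.
  bag t := S ∪ ({v | h v = t ∨ h v = t + 1} : Finset V)
  connected v := by
    have hv : h v < Finset.univ.sup h + 1 := Nat.lt_succ_of_le (Finset.le_sup (Finset.mem_univ v))
    by_cases hS : v ∈ S
    · have : {t : Fin (Finset.univ.sup h + 1) |
          v ∈ S ∪ ({v | h v = t ∨ h v = t + 1} : Finset V)} = Set.univ := by
        ext t; simp [hS]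
      rw [this]
      exact (SimpleGraph.induceUnivIso _).connected_iff.2 (SimpleGraph.pathGraph_connected _)
    · have : Nonempty {t : Fin (Finset.univ.sup h + 1) |
          v ∈ S ∪ ({v | h v = t ∨ h v = t + 1} : Finset V)} := ⟨⟨⟨h v, hv⟩, by simp⟩⟩
      refine ⟨?_⟩
      rintro ⟨s, hs⟩ ⟨t, ht⟩
      have hs : h v = s ∨ h v = s + 1 := by simpa [hS] using hs
      have ht : h v = t ∨ h v = t + 1 := by simpa [hS] using ht
      by_cases e : s = t
      · subst e; rfl
      · refine SimpleGraph.Adj.reachable ?_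
        rw [SimpleGraph.comap_adj]
        have : (s : ℕ) ≠ t := fun h => e (Fin.ext h)
        simp only [SimpleGraph.pathGraph_adj, Function.Embedding.subtype_apply]
        omega
  covering u v huv := by
    have hlt : ∀ v, h v < Finset.univ.sup h + 1 := fun v =>
      Nat.lt_succ_of_le (Finset.le_sup (Finset.mem_univ v))
    by_cases hu : u ∈ S
    · exact ⟨⟨h v, hlt v⟩, by simp [hu], by simp⟩
    by_cases hv : v ∈ S
    · exact ⟨⟨h u, hlt u⟩, by simp, by simp [hv]⟩
    have h₁ : h u ≤ h v + 1 := by simpa [hu, hv] using hadj u v huv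
    have h₂ : h v ≤ h u + 1 := by simpa [hu, hv] using hadj v u huv.symm
    rcases le_total (h u) (h v) with hle | hle
    · refine ⟨⟨h u, hlt u⟩, by simp, ?_⟩
      simp only [Finset.mem_union, Finset.mem_filter, Finset.mem_univ, true_and]
      omega
    · refine ⟨⟨h v, hlt v⟩, ?_, by simp⟩
      simp only [Finset.mem_union, Finset.mem_filter, Finset.mem_univ, true_and]
      omega

open Classical in
lemma treewidth_le_of_level (hadj : ∀ u v, G.Adj u v → u ∈ S ∨ v ∈ S ∨ h u ≤ h v + 1) (n B : ℕ)
    (hS : S.card ≤ n) (hB : ∀ j, ({v | v ∉ S ∧ h v = j} : Finset V).card ≤ B) :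
    treewidth G ≤ n + 2 * B := by
  have hle : treewidth G ≤ (levelDecomposition G S h hadj).width :=
    Nat.sInf_le (Set.mem_range_self _)
  refine hle.trans ?_
  refine (Nat.sub_le _ _).trans (Finset.sup_le fun t _ => ?_)
  change (S ∪ ({v | h v = t ∨ h v = t + 1} : Finset V)).card ≤ _
  have hsub : S ∪ ({v | h v = t ∨ h v = t + 1} : Finset V) ⊆
      S ∪ (({v | v ∉ S ∧ h v = t} : Finset V) ∪ ({v | v ∉ S ∧ h v = t + 1} : Finset V)) := by
    intro v hv
    simp only [Finset.mem_union, Finset.mem_filter, Finset.mem_univ, true_and] at hv ⊢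
    tauto
  have h₁ := Finset.card_union_le S
    (({v | v ∉ S ∧ h v = t} : Finset V) ∪ ({v | v ∉ S ∧ h v = t + 1} : Finset V))
  have h₂ := Finset.card_union_le
    ({v | v ∉ S ∧ h v = t} : Finset V) ({v | v ∉ S ∧ h v = t + 1} : Finset V)
  have := Finset.card_le_card hsub
  have := hB t
  have := hB (t + 1)
  omega

end

/-! ### The primal graph and the incidence graph of the weighted 2-CNF -/

lemma clauses_reduct_cases {ts : List (Option Literal)} {C : Clause}
    (hC : C ∈ (reduct ts).formula.clauses) :
    (∃ c, ∃ h : c < ts.length, C ∈ (block c ts[c]).map Entry.clause) ∨ C = ∅ := by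
  obtain ⟨p, hp, rfl⟩ := mem_clauses_reduct.1 hC
  rcases mem_entries.1 hp with ⟨i, hi, hp⟩ | rfl
  · rw [Nat.zero_add] at hp
    exact Or.inl ⟨i, hi, List.mem_map_of_mem hp⟩
  · exact Or.inr rfl

/-- The variables of a clause of a block. -/
lemma vars_block {c : ℕ} {t : Option Literal} {C : Clause}
    (hC : C ∈ (block c t).map Entry.clause) {v : ℕ} (hv : v ∈ clauseVars C) :
    v = chainVar c ∨ v = chainVar (c + 1) ∨ v = selVar (c + 1) ∨
      ∃ l, t = some l ∧ v = origVar l.var := by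
  cases t with
  | none =>
    simp only [block, List.map_cons, List.map_nil, List.mem_cons, List.not_mem_nil, or_false] at hC
    rcases hC with rfl | rfl <;> simp [clauseVars] at hv <;> simp [hv]
  | some l =>
    simp only [block, List.map_cons, List.map_nil, List.mem_cons, List.not_mem_nil, or_false] at hC
    rcases hC with rfl | rfl | rfl | rfl | rfl | rfl <;> simp [clauseVars] at hv
    all_goals first
      | (rcases hv with hv | hv <;> simp [hv])
      | simp [hv]

lemma level_of_mem_map_block {c : ℕ} {t : Option Literal} {C : Clause}
    (hC : C ∈ (block c t).map Entry.clause) : level C = c + 1 := by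
  obtain ⟨p, hp, rfl⟩ := List.mem_map.1 hC
  exact level_of_mem_block hp

lemma vars_reduct {L : List (List Literal)} {φ : CNF} (hL : IsListing L φ) {v : ℕ}
    (hv : v ∈ (reduct (tokens L)).formula.clauses.vars) :
    v ∈ φ.vars.image origVar ∨ v = chainVar (varLevel v) ∨ v = selVar (varLevel v) := by
  obtain ⟨C, hC, hv⟩ := Finset.mem_biUnion.1 hv
  rcases clauses_reduct_cases hC with ⟨c, hc, hC⟩ | rfl
  · rcases vars_block hC hv with rfl | rfl | rfl | ⟨l, hl, rfl⟩
    · simp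
    · simp
    · simp
    · refine Or.inl (Finset.mem_image_of_mem _ ?_)
      have : some l ∈ tokens L := hl ▸ List.getElem_mem hc
      obtain ⟨ls, hls, hl⟩ := List.mem_flatMap.1 this
      have hl : l ∈ ls := by simpa using hl
      rw [CNF.vars, ← hL.clauses_eq]
      refine Finset.mem_biUnion.2 ⟨ls.toFinset, by simpa using ⟨ls, hls, rfl⟩, ?_⟩
      exact Finset.mem_image_of_mem _ (List.mem_toFinset.2 hl)
  · simp [clauseVars] at hv

lemma odd_of_vars {L : List (List Literal)} {φ : CNF} (hL : IsListing L φ) {v : ℕ}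
    (hv : v ∈ (reduct (tokens L)).formula.clauses.vars) (ho : v % 2 = 1) :
    v ∈ φ.vars.image origVar := by
  rcases vars_reduct hL hv with h | h | h
  · exact h
  · rw [h, chainVar] at ho; omega
  · rw [h, selVar] at ho; omega

lemma varLevel_le {c : ℕ} {t : Option Literal} {C : Clause}
    (hC : C ∈ (block c t).map Entry.clause) {v : ℕ} (hv : v ∈ clauseVars C) :
    v % 2 = 1 ∨ varLevel v = c ∨ varLevel v = c + 1 := by
  rcases vars_block hC hv with rfl | rfl | rfl | ⟨l, -, rfl⟩
  · simp
  · simp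
  · simp
  · left; rw [origVar]; omega

lemma card_odd_vars_le {L : List (List Literal)} {φ : CNF} (hL : IsListing L φ)
    (T : Finset ℕ) (hT : ∀ v ∈ T, v ∈ (reduct (tokens L)).formula.clauses.vars ∧ v % 2 = 1) :
    T.card ≤ φ.vars.card :=
  (Finset.card_le_card fun v hv => odd_of_vars hL (hT v hv).1 (hT v hv).2).trans
    Finset.card_image_le

lemma card_even_vars_le {L : List (List Literal)} {φ : CNF} (hL : IsListing L φ) (j : ℕ)
    (T : Finset ℕ) (hT : ∀ v ∈ T, v ∈ (reduct (tokens L)).formula.clauses.vars ∧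
      v % 2 ≠ 1 ∧ varLevel v = j) : T.card ≤ 2 := by
  refine (Finset.card_le_card (t := {chainVar j, selVar j}) fun v hv => ?_).trans Finset.card_le_two
  obtain ⟨h₁, h₂, h₃⟩ := hT v hv
  rcases vars_reduct hL h₁ with h | h | h
  · obtain ⟨x, -, rfl⟩ := Finset.mem_image.1 h
    rw [origVar] at h₂; omega
  · rw [h₃] at h; simp [h]
  · rw [h₃] at h; simp [h]

lemma card_clauses_le {ts : List (Option Literal)} (j : ℕ) (T : Finset Clause)
    (hT : ∀ C ∈ T, C ∈ (reduct ts).formula.clauses ∧ level C = j) : T.card ≤ 7 := by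
  have hlen : ∀ c t, (block c t).length ≤ 6 := fun c t => by cases t <;> simp [block]
  -- At `j = 0` and beyond the end the default values give some other block, which is harmless since
  -- only an inclusion is needed.
  have hsub : T ⊆ insert ∅ ((block (j - 1) (ts[j - 1]?).join).map Entry.clause).toFinset := by
    intro C hC
    obtain ⟨h₁, h₂⟩ := hT C hC
    rcases clauses_reduct_cases h₁ with ⟨c, hc, h⟩ | rfl
    · have := level_of_mem_map_block h
      obtain rfl : c = j - 1 := by omega
      rw [List.getElem?_eq_getElem hc]
      simpa using Or.inr (by simpa using h)
    · simp
  refine (Finset.card_le_card hsub).trans ((Finset.card_insert_le _ _).trans ?_)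
  refine Nat.succ_le_succ ((List.toFinset_card_le _).trans ?_)
  rw [List.length_map]
  exact hlen _ _

/-- With the odd variables in all bags, a bag further contains two levels, each with at most one
chain and one selecting variable. -/
theorem tw_reduct_le {L : List (List Literal)} {φ : CNF} (hL : IsListing L φ) :
    (reduct (tokens L)).formula.tw ≤ φ.vars.card + 4 := by
  classical
  have := treewidth_le_of_level (primalGraph (reduct (tokens L)).formula.clauses)
    ({v | v.1 % 2 = 1}) (fun v => varLevel v.1) ?_ φ.vars.card 2 ?_ ?_
  · exact this
  · intro u v huv
    have huv : ∃ C ∈ (reduct (tokens L)).formula.clauses,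
        u.1 ∈ clauseVars C ∧ v.1 ∈ clauseVars C := by
      rcases huv.2 with h | ⟨C, hC, h₁, h₂⟩
      · exact h
      · exact ⟨C, hC, h₂, h₁⟩
    obtain ⟨C, hC, hu, hv⟩ := huv
    rcases clauses_reduct_cases hC with ⟨c, hc, hC⟩ | rfl
    · have h₁ := varLevel_le hC hu
      have h₂ := varLevel_le hC hv
      simp only [Finset.mem_filter, Finset.mem_univ, true_and]
      omega
    · simp [clauseVars] at hu
  · rw [← Finset.card_map (Function.Embedding.subtype _)]
    refine card_odd_vars_le hL _ fun v hv => ?_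
    obtain ⟨w, hw, rfl⟩ := Finset.mem_map.1 hv
    exact ⟨w.2, (Finset.mem_filter.1 hw).2⟩
  · intro j
    rw [← Finset.card_map (Function.Embedding.subtype _)]
    refine card_even_vars_le hL j _ fun v hv => ?_
    obtain ⟨w, hw, rfl⟩ := Finset.mem_map.1 hv
    exact ⟨w.2, by simpa using hw⟩

/-- Clauses are placed at the level of their block. A level has at most two even variables and seven
clauses (six of a block, and possibly the empty one), and a bag covers two levels. -/
theorem itw_reduct_le {L : List (List Literal)} {φ : CNF} (hL : IsListing L φ) :
    (reduct (tokens L)).formula.itw ≤ φ.vars.card + 18 := by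
  classical
  have := treewidth_le_of_level (incidenceGraph (reduct (tokens L)).formula.clauses)
    (Finset.univ.filter fun v => Sum.elim (fun _ => False) (fun x => x.1 % 2 = 1) v)
    (Sum.elim (fun C => level C.1) (fun v => varLevel v.1)) ?_ φ.vars.card 9 ?_ ?_
  · exact this
  · have key : ∀ (C : {C // C ∈ (reduct (tokens L)).formula.clauses})
        (x : {x // x ∈ (reduct (tokens L)).formula.clauses.vars}), x.1 ∈ clauseVars C.1 →
        x.1 % 2 = 1 ∨ level C.1 ≤ varLevel x.1 + 1 ∧ varLevel x.1 ≤ level C.1 + 1 := by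
      rintro ⟨C, hC⟩ ⟨x, hx⟩ h
      rcases clauses_reduct_cases hC with ⟨c, hc, hC⟩ | rfl
      · have h₁ := varLevel_le hC h
        have h₂ := level_of_mem_map_block hC
        change x % 2 = 1 ∨ level C ≤ varLevel x + 1 ∧ varLevel x ≤ level C + 1
        change x % 2 = 1 ∨ varLevel x = _ ∨ varLevel x = _ at h₁
        omega
      · simp [clauseVars] at h
    rintro (C | x) (D | y) huv
    · rcases huv.2 with h | h <;> exact h.elim
    · have h := huv.2.resolve_right id
      have := key C y h
      simp only [Finset.mem_filter, Finset.mem_univ, true_and, Sum.elim_inl, Sum.elim_inr]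
      tauto
    · have h := huv.2.resolve_left id
      have := key D x h
      simp only [Finset.mem_filter, Finset.mem_univ, true_and, Sum.elim_inl, Sum.elim_inr]
      tauto
    · rcases huv.2 with h | h <;> exact h.elim
  · rw [← Finset.card_toLeft_add_card_toRight, ← Finset.card_map (Function.Embedding.subtype _),
      ← Finset.card_map (Function.Embedding.subtype _) (s := Finset.toRight _)]
    have h₁ : ∀ T : Finset Clause, (∀ C ∈ T, False) → T.card ≤ 0 := fun T hT =>
      le_of_eq (Finset.card_eq_zero.2 (Finset.eq_empty_of_forall_notMem hT))
    refine (Nat.add_le_add (h₁ _ ?_) (card_odd_vars_le hL _ ?_)).trans (Nat.zero_add _).le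
    · intro C hC
      obtain ⟨w, hw, rfl⟩ := Finset.mem_map.1 hC
      simp at hw
    · intro v hv
      obtain ⟨w, hw, rfl⟩ := Finset.mem_map.1 hv
      exact ⟨w.2, by simpa using hw⟩
  · intro j
    rw [← Finset.card_toLeft_add_card_toRight, ← Finset.card_map (Function.Embedding.subtype _),
      ← Finset.card_map (Function.Embedding.subtype _) (s := Finset.toRight _)]
    refine Nat.add_le_add (card_clauses_le (ts := tokens L) j _ ?_) (card_even_vars_le hL j _ ?_)
    · intro C hC
      obtain ⟨w, hw, rfl⟩ := Finset.mem_map.1 hC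
      exact ⟨w.2, by simpa using hw⟩
    · intro v hv
      obtain ⟨w, hw, rfl⟩ := Finset.mem_map.1 hv
      exact ⟨w.2, by simpa using hw⟩

/-! ## The reduction -/

lemma length_tokens_le (L : List (List Literal)) :
    (tokens L).length ≤ (L.flatMap encodeClause).length := by
  rw [flatMap_encodeClause]
  induction tokens L with
  | nil => simp
  | cons t ts ih =>
    have : 1 ≤ (encodeToken t).length := by cases t <;> simp [encodeToken, encodeLiteral]
    rw [List.flatMap_cons, List.length_append, List.length_cons]
    omega

lemma output_encode (dec : Bool) (I : CNFInput) : (reduction dec).output I.encode 0 false =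
    (reduct (tokens I.list)).encode ++
      if dec then .bound :: encodeNat (2 ^ ((tokens I.list).length + 1) - 1) else [] := by
  rw [CNFInput.encode, flatMap_encodeClause, output_tokens, encode_reduct, Nat.zero_add]
  rfl

lemma polynomial_eval_mono (p : Polynomial ℕ) {a b : ℕ} (hab : a ≤ b) : p.eval a ≤ p.eval b := by
  rw [Polynomial.eval_eq_sum_range, Polynomial.eval_eq_sum_range]
  exact Finset.sum_le_sum fun i _ => Nat.mul_le_mul_left _ (Nat.pow_le_pow_left hab i)

open Classical in
/-- A machine that solves the weighted 2-CNFs that belong to CNFs yields a machine for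
satisfiability. -/
theorem ksatSolvable_of_machine {Γ₁ : Type} (M : TM2ComputableAux Sym Γ₁) (test : Γ₁ → Bool)
    (dec : Bool) (p : Polynomial ℕ) (k : ℕ) (δ C : ℝ) (hδ : 0 ≤ δ)
    (h : ∀ I : CNFInput, ∃ (y : List Γ₁) (m : ℕ),
      (m : ℝ) ≤ C * (2 : ℝ) ^ (δ * (I.formula.vars.card : ℝ)) *
        ((p.eval ((reduction dec).output I.encode 0 false).length : ℕ) : ℝ) ∧
      y.length ≤ I.encode.length + 3 ∧ y.all test = decide I.formula.Satisfiable ∧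
      Nonempty (TM2OutputsInTime M.tm
        (((reduction dec).output I.encode 0 false).map M.inputAlphabet.invFun)
        (some (y.map M.outputAlphabet.invFun)) m)) :
    KSATSolvable k fun n => (2 : ℝ) ^ (δ * (n : ℝ)) := by
  -- The first summand pays for the given machine, with `p` evaluated at a bound for the length of
  -- the transducer's output; the others pay for transducer, transfer and test.
  open Polynomial in
  refine ⟨(⌈C⌉₊ : ℕ[X]) * p.comp ((X + 1) * (100 * (X + 1 + 1))) +
    ((X + 1) * (100 * (2 * (X + 1) + 4) + 4) + (X + 1 + 1) +
      ((X + 1) * (100 * (X + 1 + 1)) + 1) + (X + 4)), composed (reduction dec) M test, ?_⟩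
  rintro ⟨I, hI⟩
  obtain ⟨y, m, hm, hy, hsat, hM⟩ := h I
  have hout := composed_outputs (test := test) (reduction_bounded dec) I.encode y m hM
  rw [hsat] at hout
  refine ⟨_, ?_, hout⟩
  set N := I.encode.length with hN
  set E : ℝ := (2 : ℝ) ^ (δ * (I.formula.vars.card : ℝ)) with hE
  -- Since `δ` is nonnegative, the exponential factor absorbs the additive polynomial terms.
  have hE1 : 1 ≤ E := Real.one_le_rpow (by norm_num) (by positivity)
  have hlen := length_output_le 0 (reduction_bounded dec) I.encode false (N + 1) (by omega)
  have hp := polynomial_eval_mono p hlen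
  simp only [Polynomial.eval_add, Polynomial.eval_mul, Polynomial.eval_natCast,
    Polynomial.eval_comp, Polynomial.eval_X, Polynomial.eval_one, Polynomial.eval_ofNat]
  set a := p.eval ((reduction dec).output I.encode 0 false).length
  set b := p.eval ((N + 1) * (100 * (N + 1 + 1)))
  set R := (N + 1) * (100 * (2 * (N + 1) + 4) + 4) + (N + 1 + 1) +
    ((N + 1) * (100 * (N + 1 + 1)) + 1) with hR
  have h₁ : ((m + (R + (y.length + 1)) : ℕ) : ℝ) ≤ C * E * a + (R + (N + 4) : ℕ) := by
    rw [Nat.cast_add]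
    refine add_le_add hm ?_
    exact_mod_cast (by omega : R + (y.length + 1) ≤ R + (N + 4))
  refine h₁.trans ?_
  have h₂ : C * E * a ≤ ⌈C⌉₊ * E * b := by
    have : (a : ℝ) ≤ b := by exact_mod_cast hp
    have := Nat.le_ceil C
    gcongr
  have h₃ : (((R + (N + 4) : ℕ)) : ℝ) ≤ E * (R + (N + 4) : ℕ) :=
    le_mul_of_one_le_left (Nat.cast_nonneg _) hE1
  calc C * E * a + (R + (N + 4) : ℕ) ≤ ⌈C⌉₊ * E * b + E * (R + (N + 4) : ℕ) := add_le_add h₂ h₃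
    _ = E * ((⌈C⌉₊ * b + (R + (N + 4)) : ℕ) : ℝ) := by push_cast; ring

/-- The numbers whose bits are all 1 are the `2 ^ j - 1`, and the bounds on `n` leave only `j = Q +
1`. -/
lemma decide_satisfiable_eq_all_bits {φ : CNF} {n Q : ℕ} (h₁ : 2 ^ (Q + 1) ≤ n + 1)
    (h₂ : n + 3 ≤ 2 ^ (Q + 2)) (h₃ : φ.Satisfiable ↔ n + 1 = 2 ^ (Q + 1)) :
    (encodeNat n).all (fun s => decide (s = .bit true)) = true ↔ φ.Satisfiable := by
  have e : (encodeNat n).all (fun s => decide (s = .bit true)) = n.bits.all id := by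
    rw [encodeNat, List.all_map]
    refine congrArg (fun f => n.bits.all f) (funext fun b => ?_)
    cases b <;> decide
  rw [e, h₃]
  constructor
  · intro h
    obtain ⟨j, hj⟩ := bits_all_true h
    have hl : Q + 1 ≤ j := (Nat.pow_le_pow_iff_right (by norm_num : 1 < 2)).1 (hj ▸ h₁)
    have hu : j < Q + 2 := (Nat.pow_lt_pow_iff_right (by norm_num : 1 < 2)).1 (by omega)
    rw [hj, (by omega : j = Q + 1)]
  · intro h
    rw [(by omega : n = 2 ^ (Q + 1) - 1), bits_two_pow_sub_one]
    simp

/-- An additive constant `d` in the parameter only costs the factor `2 ^ (δ * d)`. Computed optima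
are tested bitwise; in the decision version the answer to the bound `2 ^ (Q + 1) - 1` is the answer
to satisfiability. -/
theorem ksatSolvable_of_max2SATSolvable {κ : WCNF → ℕ} {d : ℕ}
    (hκ : ∀ (L : List (List Literal)) (φ : CNF), IsListing L φ →
      κ (reduct (tokens L)).formula ≤ φ.vars.card + d)
    {g : ℕ → ℝ} {δ C : ℝ} (hδ : 0 ≤ δ) (hC : 0 ≤ C)
    (hg : ∀ j : ℕ, g j ≤ C * (2 : ℝ) ^ (δ * (j : ℝ)))
    (h : Max2SATSolvable κ g) (k : ℕ) : KSATSolvable k fun n => (2 : ℝ) ^ (δ * (n : ℝ)) := by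
  classical
  have hgκ : ∀ I : CNFInput, g (κ (reduct (tokens I.list)).formula) ≤
      C * (2 : ℝ) ^ (δ * (d : ℝ)) * (2 : ℝ) ^ (δ * (I.formula.vars.card : ℝ)) := by
    intro I
    have h₁ : ((κ (reduct (tokens I.list)).formula : ℕ) : ℝ) ≤ I.formula.vars.card + d := by
      exact_mod_cast hκ _ _ I.isListing
    refine (hg _).trans ?_
    rw [mul_assoc, ← Real.rpow_add (by norm_num)]
    refine mul_le_mul_of_nonneg_left (Real.rpow_le_rpow_of_exponent_le (by norm_num) ?_) hC
    calc δ * _ ≤ δ * (I.formula.vars.card + d) := by gcongr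
      _ = _ := by ring
  rcases h with ⟨p, M, hM⟩ | ⟨p, M, hM⟩
  · refine ksatSolvable_of_machine M (fun s => decide (s = .bit true)) false p k δ
      (C * (2 : ℝ) ^ (δ * (d : ℝ))) hδ fun I => ?_
    obtain ⟨m, hm, ho⟩ := hM ⟨reduct (tokens I.list), reduct_isWidth _⟩
    obtain ⟨n, hn, h₁, h₂, h₃⟩ := cost_reduct I.isListing
    have hout := output_encode false I
    rw [if_neg Bool.false_ne_true, List.append_nil] at hout
    rw [hout]
    simp only [hn, encodeWeight_natCast] at ho hm
    refine ⟨_, m, hm.trans ?_, ?_, ?_, ho⟩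
    · exact mul_le_mul_of_nonneg_right (hgκ I) (Nat.cast_nonneg _)
    · rw [encodeNat, List.length_map]
      have := length_bits_le (by omega : n < 2 ^ ((tokens I.list).length + 2))
      have := length_tokens_le I.list
      change _ ≤ (I.list.flatMap encodeClause).length + 3
      omega
    · rw [Bool.eq_iff_iff, decide_eq_true_iff]
      exact decide_satisfiable_eq_all_bits h₁ h₂ h₃
  · refine ksatSolvable_of_machine M id true p k δ
      (C * (2 : ℝ) ^ (δ * (d : ℝ))) hδ fun I => ?_
    obtain ⟨m, hm, ho⟩ := hM ⟨⟨reduct (tokens I.list), reduct_isWidth _⟩,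
      2 ^ ((tokens I.list).length + 1) - 1⟩
    obtain ⟨n, hn, h₁, h₂, h₃⟩ := cost_reduct I.isListing
    have hout := output_encode true I
    rw [if_pos rfl] at hout
    rw [hout]
    refine ⟨_, m, hm.trans ?_, ?_, ?_, ho⟩
    · exact mul_le_mul_of_nonneg_right (hgκ I) (Nat.cast_nonneg _)
    · simp
    · rw [Bool.eq_iff_iff, decide_eq_true_iff, h₃]
      simp only [List.all_cons, List.all_nil, Bool.and_true, id_eq, decide_eq_true_iff, hn,
        Nat.cast_le]
      have := Nat.one_le_two_pow (n := (tokens I.list).length + 1)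
      omega

/-- Eventually `f j ≤ δ * j`; the finitely many exceptions are absorbed by the constant, as a sum of
their values. -/
lemma exists_two_rpow_le {f : ℕ → ℝ}
    (hf : Asymptotics.IsLittleO Filter.atTop f (fun k : ℕ => (k : ℝ))) {δ : ℝ} (hδ : 0 < δ) :
    ∃ C : ℝ, 0 ≤ C ∧ ∀ j : ℕ, (2 : ℝ) ^ f j ≤ C * (2 : ℝ) ^ (δ * (j : ℝ)) := by
  obtain ⟨N, hN⟩ := Filter.eventually_atTop.1 (hf.bound hδ)
  have hpos : ∀ j, 0 ≤ (2 : ℝ) ^ f j := fun j => by positivity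
  have hsum : 0 ≤ ∑ j ∈ Finset.range N, (2 : ℝ) ^ f j := Finset.sum_nonneg fun j _ => hpos j
  refine ⟨1 + ∑ j ∈ Finset.range N, (2 : ℝ) ^ f j, by positivity, fun j => ?_⟩
  have h1 : 1 ≤ (2 : ℝ) ^ (δ * (j : ℝ)) := Real.one_le_rpow (by norm_num) (by positivity)
  rcases lt_or_ge j N with hj | hj
  · have h2 := Finset.single_le_sum (fun j _ => hpos j) (Finset.mem_range.2 hj)
    nlinarith
  · have h2 := hN j hj
    rw [Real.norm_eq_abs, Real.norm_eq_abs, Nat.abs_cast] at h2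
    have h3 : (2 : ℝ) ^ f j ≤ (2 : ℝ) ^ (δ * (j : ℝ)) :=
      Real.rpow_le_rpow_of_exponent_le (by norm_num) ((le_abs_self _).trans h2)
    nlinarith

end MaxTwoSat

end

theorem mainTheorem4 :
    (MaxTwoSat.SETH → ∀ ε : ℝ, 0 < ε →
      ¬ MaxTwoSat.Max2SATSolvable MaxTwoSat.WCNF.tw
          (fun k => (2 : ℝ) ^ ((1 - ε) * (k : ℝ))) ∧
      ¬ MaxTwoSat.Max2SATSolvable MaxTwoSat.WCNF.itw
          (fun k => (2 : ℝ) ^ ((1 - ε) * ((k : ℝ) / 3)))) ∧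
    (MaxTwoSat.ETH → ∀ f : ℕ → ℝ,
      Asymptotics.IsLittleO Filter.atTop f (fun k : ℕ => (k : ℝ)) →
        ¬ MaxTwoSat.Max2SATSolvable MaxTwoSat.WCNF.tw (fun k => (2 : ℝ) ^ f k) ∧
        ¬ MaxTwoSat.Max2SATSolvable MaxTwoSat.WCNF.itw (fun k => (2 : ℝ) ^ f k)) := by
  have htw := fun (L : List (List MaxTwoSat.Literal)) (φ : MaxTwoSat.CNF) hL =>
    MaxTwoSat.tw_reduct_le (L := L) (φ := φ) hL
  have hitw := fun (L : List (List MaxTwoSat.Literal)) (φ : MaxTwoSat.CNF) hL =>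
    MaxTwoSat.itw_reduct_le (L := L) (φ := φ) hL
  refine ⟨fun hS ε hε => ?_, fun ⟨δ, hδ, hE⟩ f hf => ?_⟩
  -- The maximum keeps the exponent nonnegative when `ε > 1`.
  · have hδ : max (1 - ε) (1 / 2) < 1 := max_lt (by linarith) (by norm_num)
    have hδ₀ : 0 ≤ max (1 - ε) (1 / 2) := le_max_of_le_right (by norm_num)
    obtain ⟨k, hk⟩ := hS _ hδ
    have hle := le_max_left (1 - ε) (1 / 2)
    refine ⟨fun h => hk ?_, fun h => hk ?_⟩
    · refine MaxTwoSat.ksatSolvable_of_max2SATSolvable htw hδ₀ zero_le_one (fun j => ?_) h k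
      rw [one_mul]
      refine Real.rpow_le_rpow_of_exponent_le (by norm_num) ?_
      gcongr
    · refine MaxTwoSat.ksatSolvable_of_max2SATSolvable hitw hδ₀ zero_le_one (fun j => ?_) h k
      rw [one_mul]
      refine Real.rpow_le_rpow_of_exponent_le (by norm_num) ?_
      have hj : (0 : ℝ) ≤ j := Nat.cast_nonneg j
      -- The incidence treewidth is at most `n + 18`, so the division by 3 is not needed and is
      -- simply dropped.
      calc (1 - ε) * ((j : ℝ) / 3) ≤ max (1 - ε) (1 / 2) * ((j : ℝ) / 3) := by gcongr
        _ ≤ max (1 - ε) (1 / 2) * j := by gcongr; linarith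
  · obtain ⟨C, hC, hCf⟩ := MaxTwoSat.exists_two_rpow_le hf hδ
    exact ⟨fun h => hE (MaxTwoSat.ksatSolvable_of_max2SATSolvable htw hδ.le hC hCf h 3),
      fun h => hE (MaxTwoSat.ksatSolvable_of_max2SATSolvable hitw hδ.le hC hCf h 3)⟩
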